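/- Let $k$ be a field and let $\Lambda$ be a differential graded (DG) $k$-algebra (graded homologically by $\mathbb Z$) with zero differential, whose underlying graded algebra is the exterior $k$-algebra on alternating indeterminates $\xi_1,\dots,\xi_c$ ($c\ge 0$) of positive odd degrees. View $k$ as a DG $\Lambda$-module concentrated in degree $0$ on which every $\xi_i$ acts as zero. Then $k$ has a semifree resolution over $\Lambda$, and for every semifree resolution $\varepsilon\colon F\to k$ the following holds. Let $$S=\operatorname{Ext}_\Lambda(k,k)=H(\operatorname{Hom}_\Lambda(F,k)),$$ graded so that the class of a chain map of homological degree $n$ has degree $n$ (that is, $\operatorname{Ext}^i_\Lambda(k,k)$ sits in degree $-i$), and multiplied by composition products: $[\beta][\alpha]=[\beta\circ\widetilde\alpha]$, where $\widetilde\alpha\colon F\to F$ is a cycle of $\operatorname{Hom}_\Lambda(F,F)$ with $[\varepsilon\circ\widetilde\alpha]=[\alpha]$; such a lift always exists, and the product does not depend on the choices. Then the graded $k$-algebra $S$, with unit $[\varepsilon]$, is isomorphic to the polynomial ring $k[\chi_1,\dots,\chi_c]$ on commuting indeterminates of degrees $|\chi_i|=-(|\xi_i|+1)$. -/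

import Mathlib

universe u v w w₁ w₂ w₃ w₄

/-- A differential graded (DG) algebra over `k`, graded homologically: `A = ⨁ₙ Aₙ` with `n ∈ ℤ`,
and `d` of degree `-1` satisfying `d² = 0` and `d(ab) = d(a) b + (-1)^|a| a d(b)`. -/
structure DGAlgebra (k : Type u) [CommRing k] where
  carrier : Type v
  [ring : Ring carrier]
  [algebra : Algebra k carrier]
  gr : ℤ → Submodule k carrier
  [graded : GradedAlgebra gr]
  d : carrier →ₗ[k] carrier
  d_mem : ∀ (n : ℤ) (a : carrier), a ∈ gr n → d a ∈ gr (n - 1)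
  d_d : ∀ a : carrier, d (d a) = 0
  leibniz : ∀ (n : ℤ) (a b : carrier), a ∈ gr n → d (a * b) = d a * b + n.negOnePow • (a * d b)

attribute [instance] DGAlgebra.ring DGAlgebra.algebra DGAlgebra.graded

/-- A left DG module over the DG algebra `A`, graded homologically. -/
structure DGModule {k : Type u} [CommRing k] (A : DGAlgebra.{u, v} k) where
  carrier : Type w
  [addCommGroup : AddCommGroup carrier]
  [moduleBase : Module k carrier]
  [module : Module A.carrier carrier]
  [isScalarTower : IsScalarTower k A.carrier carrier]
  gr : ℤ → Submodule k carrier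
  [decomposition : DirectSum.Decomposition gr]
  smul_mem : ∀ (m n : ℤ) (a : A.carrier) (x : carrier), a ∈ A.gr m → x ∈ gr n → a • x ∈ gr (m + n)
  d : carrier →ₗ[k] carrier
  d_mem : ∀ (n : ℤ) (x : carrier), x ∈ gr n → d x ∈ gr (n - 1)
  d_d : ∀ x : carrier, d (d x) = 0
  leibniz : ∀ (n : ℤ) (a : A.carrier) (x : carrier), a ∈ A.gr n →
    d (a • x) = A.d a • x + n.negOnePow • (a • d x)

attribute [instance] DGModule.addCommGroup DGModule.moduleBase DGModule.module
  DGModule.isScalarTower DGModule.decomposition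

namespace DGModule

section Defs

variable {k : Type u} [CommRing k] {A : DGAlgebra.{u, v} k}

/-- `Hom_A(M, N)_n`: the homomorphisms of graded `A`-modules of (homological) degree `n`, that is,
`f(M_i) ⊆ N_{i+n}` and `f(ax) = (-1)^{n|a|} a f(x)`. -/
def homDeg (M : DGModule.{u, v, w₁} A) (N : DGModule.{u, v, w₂} A) (n : ℤ) :
    Submodule k (M.carrier →ₗ[k] N.carrier) where
  carrier := {f | (∀ (i : ℤ) (x : M.carrier), x ∈ M.gr i → f x ∈ N.gr (i + n)) ∧
    ∀ (j : ℤ) (a : A.carrier) (x : M.carrier), a ∈ A.gr j →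
      f (a • x) = (n * j).negOnePow • (a • f x)}
  zero_mem' := ⟨fun i x _ => by simp, fun j a x _ => by simp⟩
  add_mem' := by
    rintro f g ⟨hf, hf'⟩ ⟨hg, hg'⟩
    refine ⟨fun i x hx => add_mem (hf i x hx) (hg i x hx), fun j a x ha => ?_⟩
    simp [hf' j a x ha, hg' j a x ha]
  smul_mem' := by
    rintro r f ⟨hf, hf'⟩
    refine ⟨fun i x hx => Submodule.smul_mem _ _ (hf i x hx), fun j a x ha => ?_⟩
    rw [LinearMap.smul_apply, hf' j a x ha, LinearMap.smul_apply, smul_comm r, smul_comm r a]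

/-- The differential of the complex `Hom_A(M, N)` on elements of degree `n`:
`f ↦ d ∘ f - (-1)^n f ∘ d`. -/
def homD (M : DGModule.{u, v, w₁} A) (N : DGModule.{u, v, w₂} A) (n : ℤ) :
    (M.carrier →ₗ[k] N.carrier) →ₗ[k] (M.carrier →ₗ[k] N.carrier) where
  toFun f := N.d ∘ₗ f - n.negOnePow • (f ∘ₗ M.d)
  map_add' f g := by
    simp only [LinearMap.comp_add, LinearMap.add_comp, smul_add]
    abel
  map_smul' r f := by
    simp only [LinearMap.comp_smul, LinearMap.smul_comp, RingHom.id_apply, smul_sub]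
    rw [smul_comm r]

/-- Chain maps `M → N` of degree `n`: the cycles of degree `n` in `Hom_A(M, N)`. -/
def chainMaps (M : DGModule.{u, v, w₁} A) (N : DGModule.{u, v, w₂} A) (n : ℤ) :
    Submodule k (M.carrier →ₗ[k] N.carrier) :=
  homDeg M N n ⊓ LinearMap.ker (homD M N n)

/-- Null-homotopic chain maps of degree `n`: the boundaries of degree `n` in `Hom_A(M, N)`. -/
def nullHomotopic (M : DGModule.{u, v, w₁} A) (N : DGModule.{u, v, w₂} A) (n : ℤ) :
    Submodule k (M.carrier →ₗ[k] N.carrier) :=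
  (homDeg M N (n + 1)).map (homD M N (n + 1))

/-- All cycles of `Hom_A(M, N) = ⨁ₙ Hom_A(M, N)_n`: finite sums of chain maps of various degrees.
(The sum is direct, since the maps are graded of different degrees.) -/
def cycles (M : DGModule.{u, v, w₁} A) (N : DGModule.{u, v, w₂} A) :
    Submodule k (M.carrier →ₗ[k] N.carrier) :=
  ⨆ n : ℤ, chainMaps M N n

/-- All boundaries of `Hom_A(M, N)`. -/
def boundaries (M : DGModule.{u, v, w₁} A) (N : DGModule.{u, v, w₂} A) :
    Submodule k (M.carrier →ₗ[k] N.carrier) :=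
  ⨆ n : ℤ, nullHomotopic M N n

/-- The homology `H(Hom_A(M, N))`. -/
abbrev HHom (M : DGModule.{u, v, w₁} A) (N : DGModule.{u, v, w₂} A) :=
  ↥(cycles M N) ⧸ (boundaries M N).submoduleOf (cycles M N)

/-- The class `[f]` of a cycle. -/
def HHom.mk (M : DGModule.{u, v, w₁} A) (N : DGModule.{u, v, w₂} A) :
    ↥(cycles M N) →ₗ[k] HHom M N :=
  Submodule.mkQ _

/-- `H_n(Hom_A(M, N))`: the classes of chain maps of homological degree `n`
(cohomological degree `-n`). -/
def HHom.deg (M : DGModule.{u, v, w₁} A) (N : DGModule.{u, v, w₂} A) (n : ℤ) :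
    Submodule k (HHom M N) :=
  ((chainMaps M N n).submoduleOf (cycles M N)).map (HHom.mk M N)

theorem chainMaps_le_cycles (M : DGModule.{u, v, w₁} A) (N : DGModule.{u, v, w₂} A) (n : ℤ) :
    chainMaps M N n ≤ cycles M N :=
  le_iSup (chainMaps M N) n

theorem d_chainMap {M : DGModule.{u, v, w₁} A} {N : DGModule.{u, v, w₂} A} {n : ℤ}
    {f : M.carrier →ₗ[k] N.carrier} (hf : f ∈ chainMaps M N n) (x : M.carrier) :
    N.d (f x) = n.negOnePow • f (M.d x) := by
  have h : homD M N n f = 0 := hf.2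
  have h' := LinearMap.congr_fun h x
  exact sub_eq_zero.mp h'

theorem comp_mem_chainMaps {L : DGModule.{u, v, w₁} A} {M : DGModule.{u, v, w₂} A}
    {N : DGModule.{u, v, w₃} A} {m n : ℤ} {g : M.carrier →ₗ[k] N.carrier}
    {f : L.carrier →ₗ[k] M.carrier} (hg : g ∈ chainMaps M N m) (hf : f ∈ chainMaps L M n) :
    g ∘ₗ f ∈ chainMaps L N (n + m) := by
  refine ⟨⟨fun i x hx => ?_, fun j a x ha => ?_⟩, ?_⟩
  · rw [← add_assoc]
    exact hg.1.1 _ _ (hf.1.1 _ _ hx)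
  · rw [LinearMap.comp_apply, hf.1.2 j a x ha, LinearMap.map_smul_of_tower, hg.1.2 j a _ ha,
      smul_smul, ← Int.negOnePow_add, ← add_mul, LinearMap.comp_apply]
  · change homD L N (n + m) (g ∘ₗ f) = 0
    refine LinearMap.ext fun x => sub_eq_zero.mpr ?_
    change N.d (g (f x)) = (n + m).negOnePow • g (f (L.d x))
    rw [d_chainMap hg, d_chainMap hf, LinearMap.map_smul_of_tower, smul_smul,
      ← Int.negOnePow_add, add_comm m n]

theorem comp_mem_cycles {L : DGModule.{u, v, w₁} A} {M : DGModule.{u, v, w₂} A}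
    {N : DGModule.{u, v, w₃} A} {g : M.carrier →ₗ[k] N.carrier}
    {f : L.carrier →ₗ[k] M.carrier} (hg : g ∈ cycles M N) (hf : f ∈ cycles L M) :
    g ∘ₗ f ∈ cycles L N := by
  refine Submodule.iSup_induction (chainMaps M N) (motive := fun g => g ∘ₗ f ∈ cycles L N) hg
    (fun m g hg => ?_) ?_ (fun g g' h h' => ?_)
  · refine Submodule.iSup_induction (chainMaps L M) (motive := fun f => g ∘ₗ f ∈ cycles L N) hf
      (fun n f hf => chainMaps_le_cycles L N _ (comp_mem_chainMaps hg hf)) ?_ (fun f f' h h' => ?_)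
    · simp
    · rw [LinearMap.comp_add]
      exact add_mem h h'
  · simp
  · rw [LinearMap.add_comp]
    exact add_mem h h'

/-- The composite of two cycles. -/
def cyclesComp {L : DGModule.{u, v, w₁} A} {M : DGModule.{u, v, w₂} A}
    {N : DGModule.{u, v, w₃} A} (g : cycles M N) (f : cycles L M) : cycles L N :=
  ⟨g.1 ∘ₗ f.1, comp_mem_cycles g.2 f.2⟩

/-- The homology `H(M) = ker d / im d` of a DG module. -/
abbrev Homology (M : DGModule.{u, v, w} A) :=
  ↥(LinearMap.ker M.d) ⧸ (LinearMap.range M.d).submoduleOf (LinearMap.ker M.d)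

/-- A morphism of DG modules is a chain map of degree `0`. It is `A`-linear and commutes with the
differentials. -/
abbrev Hom (M : DGModule.{u, v, w₁} A) (N : DGModule.{u, v, w₂} A) := ↥(chainMaps M N 0)

theorem Hom.d_apply {M : DGModule.{u, v, w₁} A} {N : DGModule.{u, v, w₂} A} (f : Hom M N)
    (x : M.carrier) : N.d (f.1 x) = f.1 (M.d x) := by
  simpa using d_chainMap f.2 x

/-- The map `H(M) → H(N)` induced by a morphism. -/
def homologyMap {M : DGModule.{u, v, w₁} A} {N : DGModule.{u, v, w₂} A} (f : Hom M N) :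
    Homology M →ₗ[k] Homology N :=
  Submodule.mapQ _ _
    (f.1.restrict (p := LinearMap.ker M.d) (q := LinearMap.ker N.d) (fun x hx => by
      rw [LinearMap.mem_ker] at hx ⊢
      rw [Hom.d_apply, hx, map_zero]))
    (by
      rintro ⟨x, hx⟩ ⟨y, hy⟩
      refine ⟨f.1 y, ?_⟩
      rw [Hom.d_apply, hy]
      rfl)

/-- Quasi-isomorphisms: morphisms inducing an isomorphism in homology. -/
def IsQuasiIso {M : DGModule.{u, v, w₁} A} {N : DGModule.{u, v, w₂} A} (f : Hom M N) : Prop :=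
  Function.Bijective (homologyMap f)

/-- A DG submodule: an `A`-submodule that is graded and closed under the differential. -/
def IsDGSubmodule (M : DGModule.{u, v, w} A) (P : Submodule A.carrier M.carrier) : Prop :=
  (∀ x ∈ P, ∀ n : ℤ, (DirectSum.decompose M.gr x n : M.carrier) ∈ P) ∧ ∀ x ∈ P, M.d x ∈ P

/-- `F` is semifree: it has an exhaustive filtration `0 = F⁰ ⊆ F¹ ⊆ ⋯` by DG submodules such that
each DG module `Fⁿ⁺¹/Fⁿ` is isomorphic to a direct sum of suspensions of `A`. The latter means that
`Fⁿ⁺¹/Fⁿ ⊆ F/Fⁿ` has an `A`-basis consisting of homogeneous cycles (the images of the generators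
of the suspensions of `A`); we write this basis as the classes of homogeneous elements `x j` of
`Fⁿ⁺¹`. -/
def IsSemifree (F : DGModule.{u, v, w} A) : Prop :=
  ∃ Fil : ℕ → Submodule A.carrier F.carrier,
    Fil 0 = ⊥ ∧ Monotone Fil ∧ (∀ x : F.carrier, ∃ n, x ∈ Fil n) ∧
    (∀ n, F.IsDGSubmodule (Fil n)) ∧
    ∀ n, ∃ (ι : Type w) (x : ι → F.carrier),
      (∀ j, ∃ m : ℤ, x j ∈ F.gr m) ∧
      (∀ j, F.d (x j) ∈ Fil n) ∧
      LinearIndependent A.carrier (fun j => (Fil n).mkQ (x j)) ∧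
      Fil n ⊔ Submodule.span A.carrier (Set.range x) = Fil (n + 1)

/-- A semifree resolution of `U`: a quasi-isomorphism `ε : F → U` with `F` semifree. -/
structure SemifreeResolution (U : DGModule.{u, v, w₁} A) where
  F : DGModule.{u, v, w} A
  semifree : F.IsSemifree
  ε : Hom F U
  quasiIso : IsQuasiIso ε

namespace SemifreeResolution

/-- The augmentation of a resolution, as a cycle of `Hom_A(F, U)`. -/
def cycle {U : DGModule.{u, v, w₁} A} (R : SemifreeResolution.{u, v, w, w₁} U) : cycles R.F U :=
  ⟨R.ε.1, chainMaps_le_cycles _ _ 0 R.ε.2⟩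

/-- `Ext_A(U, V) = H(Hom_A(F, V))`, computed from a semifree resolution `F → U`. -/
abbrev Ext {U : DGModule.{u, v, w₁} A} (R : SemifreeResolution.{u, v, w, w₁} U)
    (V : DGModule.{u, v, w₂} A) :=
  HHom R.F V

/-- Composition products `Ext_A(V, W) × Ext_A(U, V) → Ext_A(U, W)`: with semifree resolutions
`F → U` and `ε : G → V`, the product `[β][α]` of `β : G → W` and `α : F → V` is the class
`[β ∘ α']`, where `α' : F → G` is a cycle lifting `α`, i.e. `[ε ∘ α'] = [α]`.

`IsCompositionProduct R S W b a c` says that `c` is the product of `b` and `a`: there is a lift of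
`a`, and the recipe gives `c` for every choice of representatives and of the lift. -/
def IsCompositionProduct {U : DGModule.{u, v, w₁} A} {V : DGModule.{u, v, w₂} A}
    (R : SemifreeResolution.{u, v, w, w₁} U) (S : SemifreeResolution.{u, v, w₃, w₂} V)
    (W : DGModule.{u, v, w₄} A) (b : S.Ext W) (a : R.Ext V) (c : R.Ext W) : Prop :=
  (∃ α' : cycles R.F S.F, HHom.mk R.F V (cyclesComp S.cycle α') = a) ∧
  ∀ (β : cycles S.F W) (α' : cycles R.F S.F),
    HHom.mk S.F W β = b → HHom.mk R.F V (cyclesComp S.cycle α') = a →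
      HHom.mk R.F W (cyclesComp β α') = c

end SemifreeResolution

end Defs

section Trivial

variable {k : Type u} [CommRing k] {A : DGAlgebra.{u, v} k}

/-- The grading of `k` concentrated in degree `0`. -/
def trivialGr (k : Type u) [CommRing k] (n : ℤ) : Submodule k k := if n = 0 then ⊤ else ⊥

theorem mem_trivialGr_zero (x : k) : x ∈ trivialGr k 0 := by simp [trivialGr]

theorem eq_zero_of_mem_trivialGr {n : ℤ} (hn : n ≠ 0) {x : k} (hx : x ∈ trivialGr k n) :
    x = 0 := by
  simpa [trivialGr, hn] using hx

/-- `k` is the direct sum of its homogeneous components. -/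
instance trivialDecomposition : DirectSum.Decomposition (trivialGr k) where
  decompose' x := DirectSum.of (fun n => ↥(trivialGr k n)) 0 ⟨x, mem_trivialGr_zero x⟩
  left_inv x := by simp
  right_inv x := by
    induction x using DirectSum.induction_on with
    | zero =>
      rw [map_zero]
      exact map_zero (DirectSum.of (fun n => ↥(trivialGr k n)) 0)
    | of n y =>
      rw [DirectSum.coeAddMonoidHom_of]
      by_cases hn : n = 0
      · subst hn
        rfl
      · have hy : y = 0 := Subtype.ext (eq_zero_of_mem_trivialGr hn y.2)
        subst hy
        rw [map_zero]
        exact map_zero (DirectSum.of (fun n => ↥(trivialGr k n)) 0)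
    | add x y hx hy =>
      rw [map_add]
      conv_rhs => rw [← hx, ← hy]
      exact map_add (DirectSum.of (fun n => ↥(trivialGr k n)) 0)
        (⟨_, mem_trivialGr_zero _⟩) (⟨_, mem_trivialGr_zero _⟩)

/-- `k`, concentrated in degree `0`, as a DG module over `A` via an augmentation `η : A → k`. -/
def ofAugmentation (η : A.carrier →ₐ[k] k)
    (hη : ∀ (n : ℤ) (a : A.carrier), n ≠ 0 → a ∈ A.gr n → η a = 0)
    (hd : ∀ a, η (A.d a) = 0) : DGModule.{u, v, u} A :=
  letI : Module A.carrier k := Module.compHom k η.toRingHom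
  { carrier := k
    isScalarTower := ⟨fun r a x => by
      change η (r • a) * x = r * (η a * x)
      rw [map_smul, smul_eq_mul, mul_assoc]⟩
    gr := trivialGr k
    smul_mem := fun m n a x ha hx => by
      change η a * x ∈ _
      by_cases hm : m = 0
      · by_cases hn : n = 0
        · subst hm hn
          exact mem_trivialGr_zero _
        · rw [eq_zero_of_mem_trivialGr hn hx, mul_zero]
          exact zero_mem _
      · rw [hη m a hm ha, zero_mul]
        exact zero_mem _
    d := 0
    d_mem := fun n x _ => zero_mem _
    d_d := fun x => rfl
    leibniz := fun n a x _ => by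
      change (0 : k) = η (A.d a) * x + n.negOnePow • (η a * 0)
      rw [hd]
      simp }

end Trivial

end DGModule

namespace DGAlgebra

variable {k : Type u} [Field k] {Λ : DGAlgebra.{u, v} k} {c : ℕ}

/-- For an exterior algebra on `ξ₁, …, ξ_c`, the algebra homomorphism to `k` with `ξ_i ↦ 0`. -/
def exteriorAugmentation (e : ExteriorAlgebra k (Fin c → k) ≃ₐ[k] Λ.carrier) :
    Λ.carrier →ₐ[k] k :=
  (ExteriorAlgebra.algebraMapInv (R := k) (M := Fin c → k)).comp e.symm.toAlgHom

theorem exteriorAugmentation_eq_zero (e : ExteriorAlgebra k (Fin c → k) ≃ₐ[k] Λ.carrier)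
    {deg : Fin c → ℤ} (he : ∀ i, e (ExteriorAlgebra.ι k (Pi.single i 1)) ∈ Λ.gr (deg i))
    (hpos : ∀ i, 0 < deg i) (n : ℤ) (a : Λ.carrier) (hn : n ≠ 0) (ha : a ∈ Λ.gr n) :
    exteriorAugmentation e a = 0 := by
  classical
  let P : Submodule k Λ.carrier :=
    { carrier := {a | ∀ n : ℤ, (n < 0 → (DirectSum.decompose Λ.gr a n : Λ.carrier) = 0) ∧
        (n ≠ 0 → exteriorAugmentation e (DirectSum.decompose Λ.gr a n : Λ.carrier) = 0)}
      zero_mem' := fun n => by simp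
      add_mem' := fun {a b} ha hb n => by
        refine ⟨fun h => ?_, fun h => ?_⟩
        · simp [(ha n).1 h, (hb n).1 h]
        · simp [(ha n).2 h, (hb n).2 h]
      smul_mem' := fun r a ha n => by
        refine ⟨fun h => ?_, fun h => ?_⟩
        · rw [DirectSum.decompose_smul, DirectSum.smul_apply, Submodule.coe_smul, (ha n).1 h, smul_zero]
        · rw [DirectSum.decompose_smul, DirectSum.smul_apply, Submodule.coe_smul, map_smul,
            (ha n).2 h, smul_zero] }
  have hom : ∀ (m : ℤ) (b : Λ.carrier), b ∈ Λ.gr m → 0 ≤ m →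
      (m ≠ 0 → exteriorAugmentation e b = 0) → b ∈ P := by
    intro m b hb hm hb' n
    by_cases hmn : m = n
    · subst hmn
      rw [DirectSum.decompose_of_mem_same _ hb]
      exact ⟨fun h => absurd h (not_lt.mpr hm), hb'⟩
    · rw [DirectSum.decompose_of_mem_ne _ hb hmn]
      simp
  have key : ∀ x : ExteriorAlgebra k (Fin c → k), e x ∈ P := by
    intro x
    induction x using ExteriorAlgebra.induction with
    | algebraMap r =>
      rw [AlgEquiv.commutes]
      exact hom 0 _ (SetLike.algebraMap_mem_graded Λ.gr r) le_rfl (fun h => absurd rfl h)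
    | ι y =>
      have hy : y = ∑ i, y i • (Pi.single i (1 : k) : Fin c → k) := by
        ext j
        simp [Finset.sum_apply, Pi.single_apply]
      rw [hy, map_sum, map_sum]
      refine Submodule.sum_mem _ fun i _ => ?_
      rw [map_smul, map_smul]
      refine Submodule.smul_mem _ _ (hom _ _ (he i) (hpos i).le fun _ => ?_)
      simp [exteriorAugmentation, ExteriorAlgebra.algebraMapInv]
    | mul x y hx hy =>
      intro n
      have hterm : ∀ i j : ℤ, i + j = n →
          (n < 0 → (DirectSum.decompose Λ.gr (e x) i : Λ.carrier) *
            (DirectSum.decompose Λ.gr (e y) j : Λ.carrier) = 0) ∧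
          (n ≠ 0 → exteriorAugmentation e ((DirectSum.decompose Λ.gr (e x) i : Λ.carrier) *
            (DirectSum.decompose Λ.gr (e y) j : Λ.carrier)) = 0) := by
        intro i j hij
        refine ⟨fun h => ?_, fun h => ?_⟩
        · by_cases hi : i < 0
          · rw [(hx i).1 hi, zero_mul]
          · rw [(hy j).1 (by omega), mul_zero]
        · rw [map_mul]
          by_cases hi : i = 0
          · rw [(hy j).2 (by omega), mul_zero]
          · rw [(hx i).2 hi, zero_mul]
      rw [map_mul, DirectSum.decompose_mul, DirectSum.coe_mul_apply]
      refine ⟨fun h => Finset.sum_eq_zero fun ij hij => ?_, fun h => ?_⟩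
      · exact (hterm ij.1 ij.2 (Finset.mem_filter.mp hij).2).1 h
      · rw [map_sum]
        exact Finset.sum_eq_zero fun ij hij =>
          (hterm ij.1 ij.2 (Finset.mem_filter.mp hij).2).2 h
    | add x y hx hy =>
      rw [map_add]
      exact add_mem hx hy
  have h := (key (e.symm a) n).2 hn
  rwa [AlgEquiv.apply_symm_apply, DirectSum.decompose_of_mem_same _ ha] at h

/-- The DG `Λ`-module `k`, for `Λ` with zero differential and exterior on generators `ξ_i` of
positive degrees: `k` sits in degree `0`, and the `ξ_i` act as zero. -/
def residueModule (Λ : DGAlgebra.{u, v} k) (e : ExteriorAlgebra k (Fin c → k) ≃ₐ[k] Λ.carrier)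
    {deg : Fin c → ℤ} (he : ∀ i, e (ExteriorAlgebra.ι k (Pi.single i 1)) ∈ Λ.gr (deg i))
    (hpos : ∀ i, 0 < deg i) (hd : Λ.d = 0) : DGModule.{u, v, u} Λ :=
  DGModule.ofAugmentation (exteriorAugmentation e) (exteriorAugmentation_eq_zero e he hpos)
    (fun a => by rw [hd]; exact map_zero _)

end DGAlgebra

/-! The Koszul resolution K of k is free over Λ on divided power monomials y⁽ᵃ⁾, with |yᵢ| = |ξᵢ| +
1 and d y⁽ᵃ⁾ = ∑ᵢ ξᵢ y⁽ᵃ⁻ᵉⁱ⁾. Contracting ξᵢ while raising the exponent of yᵢ gives a map hᵢ with d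
hᵢ + hᵢ d = 1 - πᵢ, where πᵢ projects onto the part free of ξᵢ and yᵢ. Eliminating the variables one
at a time leaves only k (`exists_koszul_sub_eq`). Divided powers avoid denominators, so the
characteristic plays no role.

Graded homomorphisms K → k kill every multiple of the ξᵢ, hence the image of d: Hom(K, k) has zero
differential (`boundaries_koszul_eq_bot`). One of degree n is a function on the finitely many
monomials of degree -n, that is, a homogeneous polynomial. The monomial χᵃ acts on K by y⁽ᵇ⁾ ↦
y⁽ᵇ⁻ᵃ⁾. This is a chain map because |χᵢ| is even. If T is the resulting action of polynomials, ε ∘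
T(p) takes y⁽ᵇ⁾ to the coefficient of p at b (`koszulAugmentation_polyAction`,
`exists_polyAction_eq`). So T(p) lifts the class of p, and multiplicativity of T is multiplicativity
of Ext.

For an arbitrary resolution F, `IsSemifree.exists_lift` says that Hom(F, -) makes the mapping cone
of a quasi-isomorphism acyclic. It yields maps g : F → K and h : K → F inverse up to homotopy. The
isomorphism sends p to [ε T(p) g], and h T(q) g lifts the class of q. -/

namespace DGModule

/-! ### Graded homomorphisms and their values on a basis -/

section HomBasics

variable {k : Type u} [CommRing k] {A : DGAlgebra.{u, v} k}

theorem homD_apply (M : DGModule.{u, v, w₁} A) (N : DGModule.{u, v, w₂} A) (n : ℤ)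
    (f : M.carrier →ₗ[k] N.carrier) (x : M.carrier) :
    homD M N n f x = N.d (f x) - n.negOnePow • f (M.d x) := rfl

theorem homD_mem_homDeg {M : DGModule.{u, v, w₁} A} {N : DGModule.{u, v, w₂} A} {n : ℤ}
    {f : M.carrier →ₗ[k] N.carrier} (hf : f ∈ homDeg M N (n + 1)) :
    homD M N (n + 1) f ∈ homDeg M N n := by
  refine ⟨fun i x hx => ?_, fun j a x ha => ?_⟩
  · rw [homD_apply]
    refine sub_mem ?_ ?_
    · have := N.d_mem _ _ (hf.1 i x hx)
      rwa [show i + (n + 1) - 1 = i + n by ring] at this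
    · have := hf.1 _ _ (M.d_mem _ _ hx)
      rw [show i - 1 + (n + 1) = i + n by ring] at this
      rw [Units.smul_def]
      exact zsmul_mem this _
  · simp only [homD_apply]
    rw [hf.2 j a x ha, M.leibniz j a x ha, map_add, hf.2 (j - 1) (A.d a) x (A.d_mem _ _ ha),
      LinearMap.map_smul_of_tower N.d ((n + 1) * j).negOnePow,
      LinearMap.map_smul_of_tower f j.negOnePow, hf.2 j a _ ha, N.leibniz j a _ ha]
    -- The three signs are treated as independent: the identity is formal in them, so all eight
    -- cases hold.
    have hnj : (n * j).negOnePow = 1 ∨ (n * j).negOnePow = -1 := Int.units_eq_one_or _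
    rcases Int.units_eq_one_or n.negOnePow with hn | hn <;>
    rcases Int.units_eq_one_or j.negOnePow with hj | hj <;>
    rcases hnj with hnj | hnj <;>
    simp [hn, hj, hnj, Int.negOnePow_sub, Int.negOnePow_add, smul_sub, add_mul, mul_sub] <;>
    abel

/-- A graded homomorphism vanishing on a set vanishes on the submodule it spans. -/
theorem eq_zero_of_mem_span {M : DGModule.{u, v, w₁} A} {N : DGModule.{u, v, w₂} A} {n : ℤ}
    {f : M.carrier →ₗ[k] N.carrier} (hf : f ∈ homDeg M N n) {s : Set M.carrier}
    (hs : ∀ x ∈ s, f x = 0) {x : M.carrier} (hx : x ∈ Submodule.span A.carrier s) : f x = 0 := by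
  induction hx using Submodule.span_induction with
  | mem x hx => exact hs x hx
  | zero => exact map_zero f
  | add x y _ _ hx hy => rw [map_add, hx, hy, add_zero]
  | smul a x _ hx =>
    induction a using DirectSum.Decomposition.inductionOn A.gr with
    | zero => simp
    | homogeneous a => rw [hf.2 _ _ x a.2, hx, smul_zero, smul_zero]
    | add a b ha hb => rw [add_smul, map_add, ha, hb, add_zero]

/-- The `k`-linear map `a ↦ (-1)^{n|a|} a`. -/
noncomputable def twist (A : DGAlgebra.{u, v} k) (n : ℤ) : A.carrier →ₗ[k] A.carrier :=
  DirectSum.toModule k ℤ A.carrier (fun j => (n * j).negOnePow • (A.gr j).subtype) ∘ₗ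
    (DirectSum.decomposeLinearEquiv A.gr).toLinearMap

theorem twist_of_mem (n : ℤ) {j : ℤ} {a : A.carrier} (ha : a ∈ A.gr j) :
    twist A n a = (n * j).negOnePow • a := by
  lift a to A.gr j using ha
  simp only [twist, LinearMap.comp_apply, LinearEquiv.coe_coe,
    DirectSum.decomposeLinearEquiv_apply, DirectSum.decompose_coe]
  erw [DirectSum.toModule_lof]
  rfl

variable {F : DGModule.{u, v, w₁} A} {N : DGModule.{u, v, w₂} A} {I : Type w₃}

theorem basis_induction (b : Module.Basis I A.carrier F.carrier) {motive : F.carrier → Prop}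
    (zero : motive 0) (add : ∀ x y, motive x → motive y → motive (x + y))
    (smul : ∀ (i : I) (j : ℤ) (a : A.carrier), a ∈ A.gr j → motive (a • b i))
    (x : F.carrier) : motive x := by
  obtain ⟨f, rfl⟩ := b.repr.symm.surjective x
  induction f using Finsupp.induction_linear with
  | zero => simpa using zero
  | add f g hf hg => rw [map_add]; exact add _ _ hf hg
  | single i a =>
    rw [Module.Basis.repr_symm_single]
    induction a using DirectSum.Decomposition.inductionOn A.gr with
    | zero => simpa using zero
    | homogeneous a => exact smul i _ a a.2
    | add a b ha hb => rw [add_smul]; exact add _ _ ha hb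

/-- The homomorphism of degree `n` with prescribed values on a basis. -/
noncomputable def extend (b : Module.Basis I A.carrier F.carrier) (n : ℤ) (y : I → N.carrier) :
    F.carrier →ₗ[k] N.carrier :=
  (Finsupp.lsum k fun i =>
    ((LinearMap.toSpanSingleton A.carrier N.carrier (y i)).restrictScalars k) ∘ₗ twist A n) ∘ₗ
    (b.repr.toLinearMap.restrictScalars k)

theorem extend_smul_basis (b : Module.Basis I A.carrier F.carrier) (n : ℤ) (y : I → N.carrier)
    (i : I) {j : ℤ} {a : A.carrier} (ha : a ∈ A.gr j) :
    extend b n y (a • b i) = (n * j).negOnePow • (a • y i) := by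
  simp [extend, twist_of_mem n ha, Finsupp.sum_single_index]

theorem extend_basis (b : Module.Basis I A.carrier F.carrier) (n : ℤ) (y : I → N.carrier)
    (i : I) : extend b n y (b i) = y i := by
  simpa using extend_smul_basis b n y i (SetLike.one_mem_graded A.gr)

theorem extend_mem_homDeg (b : Module.Basis I A.carrier F.carrier) {deg : I → ℤ}
    (hb : ∀ i, b i ∈ F.gr (deg i)) {n : ℤ} {y : I → N.carrier}
    (hy : ∀ i, y i ∈ N.gr (deg i + n)) : extend b n y ∈ homDeg F N n := by
  refine ⟨fun i x hx => ?_, fun j a x ha => ?_⟩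
  -- Basis induction does not stay among homogeneous elements, so the claim is restated for all
  -- components of an arbitrary element.
  · suffices ∀ x : F.carrier, ∀ i : ℤ,
        extend b n y (DirectSum.decompose F.gr x i : F.carrier) ∈ N.gr (i + n) by
      have h := this x i
      rwa [DirectSum.decompose_of_mem_same _ hx] at h
    intro x
    induction x using basis_induction b with
    | zero => simp
    | add x y hx hy => intro i; simpa using add_mem (hx i) (hy i)
    | smul i j a ha =>
      intro m
      have hm := F.smul_mem _ _ _ _ ha (hb i)
      by_cases h : j + deg i = m
      · subst h
        rw [DirectSum.decompose_of_mem_same _ hm, extend_smul_basis b n y i ha, Units.smul_def,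
          add_assoc]
        exact zsmul_mem (N.smul_mem _ _ _ _ ha (hy i)) _
      · rw [DirectSum.decompose_of_mem_ne _ hm h]
        simp
  · induction x using basis_induction b with
    | zero => simp
    | add x y hx hy => simp only [smul_add, map_add, hx, hy]
    | smul i j' a' ha' =>
      rw [smul_smul, extend_smul_basis b n y i (SetLike.mul_mem_graded ha ha'),
        extend_smul_basis b n y i ha', mul_add, Int.negOnePow_add, mul_smul, mul_smul,
        smul_comm a (n * j').negOnePow]

theorem comp_mem_homDeg {L : DGModule.{u, v, w₁} A} {M : DGModule.{u, v, w₂} A}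
    {N : DGModule.{u, v, w₃} A} {m n : ℤ} {g : M.carrier →ₗ[k] N.carrier}
    {f : L.carrier →ₗ[k] M.carrier} (hg : g ∈ homDeg M N m) (hf : f ∈ homDeg L M n) :
    g ∘ₗ f ∈ homDeg L N (n + m) := by
  refine ⟨fun i x hx => ?_, fun j a x ha => ?_⟩
  · rw [← add_assoc]
    exact hg.1 _ _ (hf.1 _ _ hx)
  · rw [LinearMap.comp_apply, hf.2 j a x ha, LinearMap.map_smul_of_tower, hg.2 j a _ ha,
      smul_smul, ← Int.negOnePow_add, ← add_mul, LinearMap.comp_apply]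

end HomBasics

end DGModule

namespace DGModule

/-! ### Bases of semifree modules and induction on levels -/

section SemifreeBasis

variable {k : Type u} [CommRing k] {A : DGAlgebra.{u, v} k}

/-- A family that is a basis of the graded pieces of an exhaustive filtration is linearly
independent. -/
theorem linearIndependent_sigma_of_filtration {R : Type*} {V : Type*} [Ring R] [AddCommGroup V]
    [Module R V] {Fil : ℕ → Submodule R V} {ι : ℕ → Type*} (x : ∀ n, ι n → V)
    (hlin : ∀ n, LinearIndependent R (fun j => (Fil n).mkQ (x n j)))
    (hmem : ∀ m n j, m < n → x m j ∈ Fil n) :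
    LinearIndependent R (fun i : Σ n, ι n => x i.1 i.2) := by
  classical
  rw [linearIndependent_iff]
  intro l hl
  by_contra hne
  have hsup : l.support.Nonempty := Finsupp.support_nonempty_iff.mpr hne
  obtain ⟨⟨n, j₀⟩, hi, hmax⟩ := Finset.exists_max_image l.support (fun i => i.1) hsup
  -- Here n is the highest level occurring in l. Modulo `Fil n` only the terms of that level
  -- survive, and these are independent.
  have hsplit : l.split n = 0 := by
    refine linearIndependent_iff.mp (hlin n) _ ?_
    have hl' := congrArg (Fil n).mkQ hl
    rw [Finsupp.linearCombination_apply, Finsupp.sigma_sum, map_zero, map_sum] at hl'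
    rw [Finset.sum_eq_single n] at hl'
    · rw [Finsupp.linearCombination_apply, ← hl', Finsupp.sum, Finsupp.sum, map_sum]
      simp
    · intro m hm hmn
      rw [Finsupp.sum, map_sum]
      refine Finset.sum_eq_zero fun j hj => ?_
      have hlj : (⟨m, j⟩ : Σ n, ι n) ∈ l.support := by
        rw [Finsupp.mem_support_iff] at hj ⊢
        rwa [Finsupp.split_apply] at hj
      rw [Submodule.mkQ_apply, Submodule.Quotient.mk_eq_zero]
      exact Submodule.smul_mem _ _ (hmem m n j (lt_of_le_of_ne (hmax _ hlj) hmn))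
    · intro hn
      rw [Finsupp.mem_splitSupport_iff_nonzero, not_not] at hn
      simp [hn]
  rw [Finsupp.mem_support_iff] at hi
  apply hi
  rw [← Finsupp.split_apply, hsplit, Finsupp.zero_apply]

/-- A semifree DG module has a homogeneous basis, with levels, such that the differential of a
basis element is a combination of basis elements of lower level. -/
theorem IsSemifree.exists_basis {F : DGModule.{u, v, w} A} (hF : F.IsSemifree) :
    ∃ (I : Type w) (b : Module.Basis I A.carrier F.carrier) (deg : I → ℤ) (level : I → ℕ),
      (∀ i, b i ∈ F.gr (deg i)) ∧
      ∀ i, F.d (b i) ∈ Submodule.span A.carrier (b '' {j | level j < level i}) := by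
  obtain ⟨Fil, h0, hmono, hex, -, hstep⟩ := hF
  choose ι x hdeg hd hlin hspan using hstep
  have hmem : ∀ m n j, m < n → x m j ∈ Fil n := by
    intro m n j hmn
    refine hmono (Nat.succ_le_of_lt hmn) ?_
    rw [Nat.succ_eq_add_one, ← hspan m]
    exact Submodule.mem_sup_right (Submodule.subset_span ⟨j, rfl⟩)
  let y : (Σ n, ι n) → F.carrier := fun i => x i.1 i.2
  have hfil : ∀ n, Fil n ≤ Submodule.span A.carrier (y '' {j | j.1 < n}) := by
    intro n
    induction n with
    | zero => rw [h0]; exact bot_le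
    | succ n ih =>
      rw [← hspan n]
      refine sup_le (ih.trans (Submodule.span_mono (Set.image_mono fun j hj => ?_)))
        (Submodule.span_mono ?_)
      · exact Nat.lt_succ_of_lt hj
      · rintro _ ⟨j, rfl⟩
        exact ⟨⟨n, j⟩, Nat.lt_succ_self n, rfl⟩
  have hli : LinearIndependent A.carrier y := linearIndependent_sigma_of_filtration x hlin hmem
  have htop : ⊤ ≤ Submodule.span A.carrier (Set.range y) := by
    intro z _
    obtain ⟨n, hn⟩ := hex z
    exact Submodule.span_mono (Set.image_subset_range _ _) (hfil n hn)
  choose deg hdeg using hdeg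
  refine ⟨Σ n, ι n, Module.Basis.mk hli htop, fun i => deg i.1 i.2, fun i => i.1, ?_, ?_⟩
  · intro i
    rw [Module.Basis.mk_apply]
    exact hdeg i.1 i.2
  · intro i
    rw [Module.Basis.coe_mk]
    exact hfil _ (hd i.1 i.2)

end SemifreeBasis

/-- Dependent choice along a level function. -/
theorem exists_forall_of_level {I : Type*} {T : I → Type*} [∀ i, Nonempty (T i)] (level : I → ℕ)
    (P : I → (∀ i, T i) → Prop)
    (hP : ∀ i φ ψ, (∀ j, level j < level i → φ j = ψ j) → φ i = ψ i → P i φ → P i ψ)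
    (hstep : ∀ i φ, (∀ j, level j < level i → P j φ) → ∃ ψ : ∀ i, T i,
      (∀ j, level j < level i → φ j = ψ j) ∧ P i ψ) :
    ∃ φ, ∀ i, P i φ := by
  classical
  -- A whole level is filled at once. Indices of equal level do not interact, since by `hP` the
  -- condition at i sees only lower levels and i itself.
  have key : ∀ n, ∀ φ : ∀ i, T i, (∀ j, level j < n → P j φ) → ∃ ψ : ∀ i, T i,
      (∀ j, level j < n → φ j = ψ j) ∧ ∀ j, level j < n + 1 → P j ψ := by
    intro n φ hφ
    have h : ∀ i, ∃ t : T i, level i = n → ∃ ψ : ∀ i, T i,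
        (∀ j, level j < level i → φ j = ψ j) ∧ P i ψ ∧ ψ i = t := by
      intro i
      by_cases hi : level i = n
      · obtain ⟨ψ, h₁, h₂⟩ := hstep i φ fun j hj => hφ j (hi ▸ hj)
        exact ⟨ψ i, fun _ => ⟨ψ, h₁, h₂, rfl⟩⟩
      · exact ⟨φ i, fun h => absurd h hi⟩
    choose t ht using h
    let χ : ∀ i, T i := fun i => if level i = n then t i else φ i
    have hχ : ∀ j, level j < n → φ j = χ j := fun j hj => (if_neg hj.ne).symm
    refine ⟨χ, hχ, fun j hj => ?_⟩
    rcases Nat.lt_succ_iff_lt_or_eq.mp hj with hj | hj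
    · exact hP j φ χ (fun i hi => hχ i (hi.trans hj)) (hχ j hj) (hφ j hj)
    · obtain ⟨ψ, h₁, h₂, h₃⟩ := ht j hj
      refine hP j ψ χ (fun i hi => ?_) (h₃.trans (if_pos hj).symm) h₂
      rw [← h₁ i hi, hχ i (hj ▸ hi)]
  choose! next hnext₁ hnext₂ using key
  let Φ : ℕ → ∀ i, T i := fun n => Nat.rec (fun i => Classical.arbitrary (T i)) next n
  have hΦ : ∀ n, ∀ j, level j < n → P j (Φ n) := by
    intro n
    induction n with
    | zero => intro j hj; exact absurd hj (Nat.not_lt_zero _)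
    | succ n ih => exact hnext₂ n (Φ n) ih
  have hstab : ∀ m n, m ≤ n → ∀ j, level j < m → Φ m j = Φ n j := by
    intro m n hmn j hj
    induction n, hmn using Nat.le_induction with
    | base => rfl
    | succ n hmn ih => exact ih.trans (hnext₁ n (Φ n) (hΦ n) j (hj.trans_le hmn))
  -- The value at i is settled at stage `level i + 1` and never changes afterwards.
  refine ⟨fun i => Φ (level i + 1) i, fun i => ?_⟩
  refine hP i (Φ (level i + 1)) _ (fun j hj => ?_) rfl (hΦ _ i (Nat.lt_succ_self _))
  exact (hstab (level j + 1) (level i + 1) (by omega) j (Nat.lt_succ_self _)).symm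

end DGModule

namespace DGModule

/-! ### Lifting through quasi-isomorphisms -/

section Lifting

variable {k : Type u} [CommRing k] {A : DGAlgebra.{u, v} k}

theorem decompose_apply_add {M : DGModule.{u, v, w₁} A} {N : DGModule.{u, v, w₂} A} {n : ℤ}
    {f : M.carrier →ₗ[k] N.carrier} (hf : ∀ i, ∀ x ∈ M.gr i, f x ∈ N.gr (i + n))
    (x : M.carrier) (i : ℤ) :
    (DirectSum.decompose N.gr (f x) (i + n) : N.carrier) = f (DirectSum.decompose M.gr x i) := by
  induction x using DirectSum.Decomposition.inductionOn M.gr with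
  | zero => simp
  | @homogeneous j x =>
    by_cases h : j = i
    · subst h
      rw [DirectSum.decompose_of_mem_same _ (hf _ _ x.2),
        DirectSum.decompose_of_mem_same _ x.2]
    · rw [DirectSum.decompose_of_mem_ne _ (hf _ _ x.2) (by simpa using h),
        DirectSum.decompose_of_mem_ne _ x.2 h, map_zero]
  | add x y hx hy => simp [hx, hy]

theorem decompose_d (M : DGModule.{u, v, w} A) (x : M.carrier) (i : ℤ) :
    (DirectSum.decompose M.gr (M.d x) i : M.carrier) =
      M.d (DirectSum.decompose M.gr x (i + 1)) := by
  have := decompose_apply_add (M := M) (N := M) (n := -1) (f := M.d) M.d_mem x (i + 1)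
  rwa [add_neg_cancel_right] at this

/-- This is acyclicity of the mapping cone of q. Injectivity in homology gives a primitive y of u;
then v - q(y) is a cycle, and surjectivity supplies a cycle z by which y is corrected so that the
difference becomes a boundary. -/
theorem IsQuasiIso.exists_mem_range {M : DGModule.{u, v, w₁} A} {N : DGModule.{u, v, w₂} A}
    {q : Hom M N} (hq : IsQuasiIso q) {u : M.carrier} {v : N.carrier} (hu : M.d u = 0)
    (hv : N.d v = q.1 u) : ∃ y w, M.d y = u ∧ N.d w = v - q.1 y := by
  obtain ⟨y, rfl⟩ : u ∈ LinearMap.range M.d := by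
    have h : homologyMap q (Submodule.Quotient.mk ⟨u, hu⟩) = homologyMap q 0 := by
      rw [map_zero]
      exact (Submodule.Quotient.mk_eq_zero _).mpr ⟨v, hv⟩
    exact (Submodule.Quotient.mk_eq_zero
      ((LinearMap.range M.d).submoduleOf (LinearMap.ker M.d))).mp (hq.1 h)
  have hcyc : N.d (v - q.1 y) = 0 := by rw [map_sub, hv, q.d_apply, sub_self]
  obtain ⟨z, hz⟩ := hq.2 (Submodule.Quotient.mk ⟨v - q.1 y, hcyc⟩)
  obtain ⟨⟨z, hz'⟩, rfl⟩ := Submodule.Quotient.mk_surjective _ z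
  obtain ⟨w, hw⟩ := (Submodule.Quotient.eq _).mp hz.symm
  refine ⟨y + z, w, ?_, ?_⟩
  · rw [map_add, LinearMap.mem_ker.mp hz', add_zero]
  · rw [hw, map_add, ← sub_sub]
    rfl

theorem IsQuasiIso.exists_lift {M : DGModule.{u, v, w₁} A} {N : DGModule.{u, v, w₂} A}
    {q : Hom M N} (hq : IsQuasiIso q) {m : ℤ} {u : M.carrier} (hum : u ∈ M.gr m) {v : N.carrier}
    (hvm : v ∈ N.gr (m + 1)) (hu : M.d u = 0) (hv : N.d v = q.1 u) :
    ∃ y ∈ M.gr (m + 1), ∃ w ∈ N.gr (m + 1 + 1), M.d y = u ∧ N.d w = v - q.1 y := by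
  obtain ⟨y, w, hy, hw⟩ := hq.exists_mem_range hu hv
  refine ⟨_, (DirectSum.decompose M.gr y (m + 1)).2, _,
    (DirectSum.decompose N.gr w (m + 1 + 1)).2, ?_, ?_⟩
  · rw [← decompose_d, hy, DirectSum.decompose_of_mem_same _ hum]
  · have := decompose_apply_add (n := 0) q.2.1.1 y (m + 1)
    rw [add_zero] at this
    rw [← decompose_d, hw, DirectSum.decompose_sub, DirectSum.sub_apply, Submodule.coe_sub, this,
      DirectSum.decompose_of_mem_same _ hvm]

/-- For `F` semifree, `Hom_A(F, -)` takes the mapping cone of a quasi-isomorphism to an acyclic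
complex. -/
theorem IsSemifree.exists_lift {F : DGModule.{u, v, w} A} (hF : F.IsSemifree)
    {M : DGModule.{u, v, w₁} A} {N : DGModule.{u, v, w₂} A} {q : Hom M N} (hq : IsQuasiIso q)
    {n : ℤ} {f : F.carrier →ₗ[k] M.carrier} (hf : f ∈ chainMaps F M n)
    {h : F.carrier →ₗ[k] N.carrier} (hh : h ∈ homDeg F N (n + 1))
    (hfh : homD F N (n + 1) h = q.1 ∘ₗ f) :
    ∃ f' ∈ homDeg F M (n + 1), ∃ h' ∈ homDeg F N (n + 1 + 1),
      homD F M (n + 1) f' = f ∧ homD F N (n + 1 + 1) h' = h - q.1 ∘ₗ f' := by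
  obtain ⟨I, b, deg, level, hb, hdb⟩ := hF.exists_basis
  -- A pair (f', h') of graded homomorphisms amounts to a choice of images of the basis elements in
  -- the right degrees. These are found by induction on the level.
  let T : I → Type _ := fun i => M.gr (deg i + (n + 1)) × N.gr (deg i + (n + 1 + 1))
  let f' : (∀ i, T i) → F.carrier →ₗ[k] M.carrier :=
    fun φ => extend b (n + 1) fun i => ((φ i).1 : M.carrier)
  let h' : (∀ i, T i) → F.carrier →ₗ[k] N.carrier :=
    fun φ => extend b (n + 1 + 1) fun i => ((φ i).2 : N.carrier)
  have hf' : ∀ φ, f' φ ∈ homDeg F M (n + 1) := fun φ => extend_mem_homDeg b hb fun i => (φ i).1.2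
  have hh' : ∀ φ, h' φ ∈ homDeg F N (n + 1 + 1) :=
    fun φ => extend_mem_homDeg b hb fun i => (φ i).2.2
  have hE₁ : ∀ φ, homD F M (n + 1) (f' φ) - f ∈ homDeg F M n :=
    fun φ => sub_mem (homD_mem_homDeg (hf' φ)) hf.1
  have hqf' : ∀ φ, q.1 ∘ₗ f' φ ∈ homDeg F N (n + 1) := fun φ => by
    simpa using comp_mem_homDeg q.2.1 (hf' φ)
  have hE₂ : ∀ φ, homD F N (n + 1 + 1) (h' φ) - (h - q.1 ∘ₗ f' φ) ∈ homDeg F N (n + 1) :=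
    fun φ => sub_mem (homD_mem_homDeg (hh' φ)) (sub_mem hh (hqf' φ))
  let P : I → (∀ i, T i) → Prop := fun i φ =>
    homD F M (n + 1) (f' φ) (b i) = f (b i) ∧
      homD F N (n + 1 + 1) (h' φ) (b i) = h (b i) - q.1 (f' φ (b i))
  have hspan₁ : ∀ i φ, (∀ j, level j < level i → P j φ) →
      homD F M (n + 1) (f' φ) (F.d (b i)) = f (F.d (b i)) := fun i φ hφ =>
    sub_eq_zero.mp <| eq_zero_of_mem_span (hE₁ φ)
      (by rintro _ ⟨j, hj, rfl⟩; exact sub_eq_zero.mpr (hφ j hj).1) (hdb i)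
  have hspan₂ : ∀ i φ, (∀ j, level j < level i → P j φ) →
      homD F N (n + 1 + 1) (h' φ) (F.d (b i)) = h (F.d (b i)) - q.1 (f' φ (F.d (b i))) :=
    fun i φ hφ => sub_eq_zero.mp <| eq_zero_of_mem_span (hE₂ φ)
      (by rintro _ ⟨j, hj, rfl⟩; exact sub_eq_zero.mpr (hφ j hj).2) (hdb i)
  have hcongr₁ : ∀ i φ ψ, (∀ j, level j < level i → φ j = ψ j) →
      f' φ (F.d (b i)) = f' ψ (F.d (b i)) := fun i φ ψ hφψ =>
    sub_eq_zero.mp <| eq_zero_of_mem_span (sub_mem (hf' φ) (hf' ψ)) (by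
      rintro _ ⟨j, hj, rfl⟩
      refine sub_eq_zero.mpr ?_
      simp only [f', extend_basis, hφψ j hj]) (hdb i)
  have hcongr₂ : ∀ i φ ψ, (∀ j, level j < level i → φ j = ψ j) →
      h' φ (F.d (b i)) = h' ψ (F.d (b i)) := fun i φ ψ hφψ =>
    sub_eq_zero.mp <| eq_zero_of_mem_span (sub_mem (hh' φ) (hh' ψ)) (by
      rintro _ ⟨j, hj, rfl⟩
      refine sub_eq_zero.mpr ?_
      simp only [h', extend_basis, hφψ j hj]) (hdb i)
  obtain ⟨φ, hφ⟩ : ∃ φ, ∀ i, P i φ := by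
    refine exists_forall_of_level level P ?_ ?_
    · rintro i φ ψ hlow hi ⟨h₁, h₂⟩
      have e₁ : f' φ (b i) = f' ψ (b i) := by simp only [f', extend_basis, hi]
      have e₂ : h' φ (b i) = h' ψ (b i) := by simp only [h', extend_basis, hi]
      rw [homD_apply, hcongr₁ i φ ψ hlow, e₁] at h₁
      rw [homD_apply, hcongr₂ i φ ψ hlow, e₂, e₁] at h₂
      exact ⟨h₁, h₂⟩
    · intro i φ hlow
      set x := F.d (b i) with hx
      have hdx : F.d x = 0 := F.d_d _
      have hxm : x ∈ F.gr (deg i - 1) := F.d_mem _ _ (hb i)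
      have h₁ := hspan₁ i φ hlow
      have h₂ := hspan₂ i φ hlow
      rw [homD_apply, ← hx, hdx, map_zero, smul_zero, sub_zero] at h₁ h₂
      have hfb : M.d (f (b i)) = n.negOnePow • f x := d_chainMap hf _
      have hhb : N.d (h (b i)) = q.1 (f (b i)) + (n + 1).negOnePow • h x :=
        sub_eq_iff_eq_add.mp (LinearMap.congr_fun hfh (b i))
      -- With f' and h' known on d(bᵢ), the two equations at bᵢ read d y = u and d w = v - q(y) for
      -- the unknown images y and w. The equations on lower levels make (u, v) a cycle of the cone.
      let u : M.carrier := f (b i) + (n + 1).negOnePow • f' φ x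
      let v : N.carrier := h (b i) + (n + 1 + 1).negOnePow • h' φ x
      have hum : u ∈ M.gr (deg i + n) := by
        have := (hf' φ).1 _ _ hxm
        rw [show deg i - 1 + (n + 1) = deg i + n by ring] at this
        refine add_mem (hf.1.1 _ _ (hb i)) ?_
        rw [Units.smul_def]
        exact zsmul_mem this _
      have hvm : v ∈ N.gr (deg i + n + 1) := by
        have := (hh' φ).1 _ _ hxm
        rw [show deg i - 1 + (n + 1 + 1) = deg i + n + 1 by ring] at this
        have h' := hh.1 _ _ (hb i)
        rw [← add_assoc] at h'
        refine add_mem h' ?_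
        rw [Units.smul_def]
        exact zsmul_mem this _
      have hdu : M.d u = 0 := by
        simp only [u]
        rw [map_add, LinearMap.map_smul_of_tower M.d (n + 1).negOnePow, h₁, hfb]
        simp [Int.negOnePow_succ]
      have hdv : N.d v = q.1 u := by
        simp only [u, v]
        rw [map_add, map_add, LinearMap.map_smul_of_tower N.d (n + 1 + 1).negOnePow,
          LinearMap.map_smul_of_tower q.1 (n + 1).negOnePow, h₂, hhb]
        simp only [Int.negOnePow_succ, smul_sub, neg_neg, Units.neg_smul]
        abel
      obtain ⟨y, hy, w, hw, hdy, hdw⟩ := hq.exists_lift hum hvm hdu hdv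
      rw [add_assoc] at hy
      rw [add_assoc, add_assoc, ← add_assoc n] at hw
      classical
      refine ⟨Function.update φ i (⟨y, hy⟩, ⟨w, hw⟩), ?_, ?_⟩
      · intro j hj
        rw [Function.update_of_ne]
        rintro rfl
        exact lt_irrefl _ hj
      · have hlow' : ∀ j, level j < level i →
            φ j = Function.update φ i (⟨y, hy⟩, ⟨w, hw⟩) j := by
          intro j hj
          rw [Function.update_of_ne]
          rintro rfl
          exact lt_irrefl _ hj
        have e₁ : f' (Function.update φ i (⟨y, hy⟩, ⟨w, hw⟩)) (b i) = y := by
          simp [f', extend_basis]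
        have e₂ : h' (Function.update φ i (⟨y, hy⟩, ⟨w, hw⟩)) (b i) = w := by
          simp [h', extend_basis]
        refine ⟨?_, ?_⟩
        · rw [homD_apply, ← hcongr₁ i φ _ hlow', e₁, hdy]
          exact add_sub_cancel_right _ _
        · rw [homD_apply, ← hcongr₂ i φ _ hlow', e₂, e₁, hdw]
          simp only [v]
          abel
  refine ⟨f' φ, hf' φ, h' φ, hh' φ, ?_, ?_⟩
  · ext x
    exact sub_eq_zero.mp <| eq_zero_of_mem_span (hE₁ φ) (s := Set.range b)
      (by rintro _ ⟨j, rfl⟩; exact sub_eq_zero.mpr (hφ j).1) (by simp [b.span_eq])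
  · ext x
    exact sub_eq_zero.mp <| eq_zero_of_mem_span (hE₂ φ) (s := Set.range b)
      (by rintro _ ⟨j, rfl⟩; exact sub_eq_zero.mpr (hφ j).2) (by simp [b.span_eq])

end Lifting

/-! ### Composition and homotopy -/

section Composition

variable {k : Type u} [CommRing k] {A : DGAlgebra.{u, v} k} {L : DGModule.{u, v, w₁} A}
  {M : DGModule.{u, v, w₂} A} {N : DGModule.{u, v, w₃} A}

theorem nullHomotopic_le_homDeg (M : DGModule.{u, v, w₁} A) (N : DGModule.{u, v, w₂} A) (n : ℤ) :
    nullHomotopic M N n ≤ homDeg M N n := by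
  rintro _ ⟨h, hh, rfl⟩
  exact homD_mem_homDeg hh

theorem comp_mem_nullHomotopic_left {m n : ℤ} {g : M.carrier →ₗ[k] N.carrier}
    {f : L.carrier →ₗ[k] M.carrier} (hg : g ∈ chainMaps M N m) (hf : f ∈ nullHomotopic L M n) :
    g ∘ₗ f ∈ nullHomotopic L N (n + m) := by
  obtain ⟨h, hh, rfl⟩ := hf
  -- The sign compensates for D(g h) = (-1)ᵐ g D(h), valid for a cycle g of degree m.
  refine ⟨m.negOnePow • (g ∘ₗ h), ?_, ?_⟩
  · have := comp_mem_homDeg hg.1 hh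
    rw [add_right_comm] at this
    rw [Units.smul_def]
    exact zsmul_mem this _
  · ext x
    simp only [homD_apply, LinearMap.smul_apply, LinearMap.comp_apply, map_sub,
      LinearMap.map_smul_of_tower N.d m.negOnePow, LinearMap.map_smul_of_tower g (n + 1).negOnePow,
      d_chainMap hg, smul_smul, ← Int.negOnePow_add]
    rw [show m + m = 2 * m by ring, Int.negOnePow_two_mul, one_smul,
      show n + m + 1 + m = n + 1 + 2 * m by ring, Int.negOnePow_add, Int.negOnePow_two_mul, mul_one]

theorem comp_mem_nullHomotopic_right {m n : ℤ} {g : M.carrier →ₗ[k] N.carrier}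
    {f : L.carrier →ₗ[k] M.carrier} (hg : g ∈ nullHomotopic M N m) (hf : f ∈ chainMaps L M n) :
    g ∘ₗ f ∈ nullHomotopic L N (n + m) := by
  obtain ⟨h, hh, rfl⟩ := hg
  refine ⟨h ∘ₗ f, ?_, ?_⟩
  · have := comp_mem_homDeg hh hf.1
    rwa [← add_assoc] at this
  · ext x
    simp only [homD_apply, LinearMap.comp_apply, d_chainMap hf,
      LinearMap.map_smul_of_tower h n.negOnePow, smul_smul, ← Int.negOnePow_add]
    rw [show m + 1 + n = n + m + 1 by ring]

theorem comp_mem_boundaries_left {g : M.carrier →ₗ[k] N.carrier} {f : L.carrier →ₗ[k] M.carrier}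
    (hg : g ∈ cycles M N) (hf : f ∈ boundaries L M) : g ∘ₗ f ∈ boundaries L N := by
  refine Submodule.iSup_induction _ (motive := fun g => g ∘ₗ f ∈ boundaries L N) hg
    (fun m g hg => ?_) (by simp) (fun g g' h h' => ?_)
  · refine Submodule.iSup_induction _ (motive := fun f => g ∘ₗ f ∈ boundaries L N) hf
      (fun n f hf => Submodule.mem_iSup_of_mem _ (comp_mem_nullHomotopic_left hg hf)) (by simp)
      (fun f f' h h' => ?_)
    rw [LinearMap.comp_add]
    exact add_mem h h'
  · rw [LinearMap.add_comp]
    exact add_mem h h'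

theorem comp_mem_boundaries_right {g : M.carrier →ₗ[k] N.carrier} {f : L.carrier →ₗ[k] M.carrier}
    (hg : g ∈ boundaries M N) (hf : f ∈ cycles L M) : g ∘ₗ f ∈ boundaries L N := by
  refine Submodule.iSup_induction _ (motive := fun g => g ∘ₗ f ∈ boundaries L N) hg
    (fun m g hg => ?_) (by simp) (fun g g' h h' => ?_)
  · refine Submodule.iSup_induction _ (motive := fun f => g ∘ₗ f ∈ boundaries L N) hf
      (fun n f hf => Submodule.mem_iSup_of_mem _ (comp_mem_nullHomotopic_right hg hf)) (by simp)
      (fun f f' h h' => ?_)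
    rw [LinearMap.comp_add]
    exact add_mem h h'
  · rw [LinearMap.add_comp]
    exact add_mem h h'

/-- Homomorphisms of different degrees are independent. -/
theorem eq_of_sum_homDeg_eq {f g : ℤ →₀ (M.carrier →ₗ[k] N.carrier)}
    (hf : ∀ n, f n ∈ homDeg M N n) (hg : ∀ n, g n ∈ homDeg M N n)
    (h : (f.sum fun _ x => x) = g.sum fun _ x => x) (n : ℤ) : f n = g n := by
  -- On elements of degree i, the summand of degree n is the component of degree i + n of the whole
  -- sum.
  have hcomp : ∀ f : ℤ →₀ (M.carrier →ₗ[k] N.carrier), (∀ n, f n ∈ homDeg M N n) →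
      ∀ i, ∀ x ∈ M.gr i,
        f n x = DirectSum.decompose N.gr ((f.sum fun _ x => x) x) (i + n) := by
    intro f hf i x hx
    rw [Finsupp.sum, LinearMap.sum_apply, DirectSum.decompose_sum, DFinsupp.finsetSum_apply,
      AddSubmonoidClass.coe_finsetSum, Finset.sum_eq_single n]
    · rw [DirectSum.decompose_of_mem_same _ ((hf n).1 i x hx)]
    · intro m _ hm
      exact DirectSum.decompose_of_mem_ne _ ((hf m).1 i x hx) (by simpa using hm)
    · intro hn
      rw [Finsupp.notMem_support_iff.mp hn]
      simp
  ext x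
  induction x using DirectSum.Decomposition.inductionOn M.gr with
  | zero => simp
  | @homogeneous i x => rw [hcomp f hf i x x.2, hcomp g hg i x x.2, h]
  | add x y hx hy => rw [map_add, map_add, hx, hy]

end Composition

/-! ### Maps out of semifree modules in homology -/

section SemifreeHom

variable {k : Type u} [CommRing k] {A : DGAlgebra.{u, v} k} {F : DGModule.{u, v, w} A}
  {M : DGModule.{u, v, w₁} A} {N : DGModule.{u, v, w₂} A} {q : Hom M N}

/-- Surjectivity of Hom(F, q) in homology: the case f = 0 of `IsSemifree.exists_lift`. -/
theorem IsSemifree.exists_chainMap_lift (hF : F.IsSemifree) (hq : IsQuasiIso q) {n : ℤ}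
    {z : F.carrier →ₗ[k] N.carrier} (hz : z ∈ chainMaps F N n) :
    ∃ z' ∈ chainMaps F M n, z - q.1 ∘ₗ z' ∈ boundaries F N := by
  obtain ⟨n, rfl⟩ : ∃ m, n = m + 1 := ⟨n - 1, by ring⟩
  obtain ⟨f', hf', h', hh', h₁, h₂⟩ := hF.exists_lift hq (n := n) (f := 0) (zero_mem _) (h := z)
    hz.1 (by rw [LinearMap.comp_zero]; exact hz.2)
  exact ⟨f', ⟨hf', h₁⟩, Submodule.mem_iSup_of_mem _ ⟨h', hh', h₂⟩⟩

theorem IsSemifree.mem_nullHomotopic (hF : F.IsSemifree) (hq : IsQuasiIso q) {n : ℤ}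
    {f : F.carrier →ₗ[k] M.carrier} (hf : f ∈ chainMaps F M n)
    (hqf : q.1 ∘ₗ f ∈ nullHomotopic F N n) : f ∈ nullHomotopic F M n := by
  obtain ⟨h, hh, hfh⟩ := hqf
  obtain ⟨f', hf', -, -, h₁, -⟩ := hF.exists_lift hq hf hh hfh
  exact ⟨f', hf', h₁⟩

theorem IsSemifree.mem_boundaries (hF : F.IsSemifree) (hq : IsQuasiIso q)
    {f : F.carrier →ₗ[k] M.carrier} (hf : f ∈ cycles F M)
    (hqf : q.1 ∘ₗ f ∈ boundaries F N) : f ∈ boundaries F M := by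
  obtain ⟨φ, hφ, rfl⟩ := (Submodule.mem_iSup_iff_exists_finsupp _ _).mp hf
  obtain ⟨ψ, hψ, hψφ⟩ := (Submodule.mem_iSup_iff_exists_finsupp _ _).mp hqf
  have hqφ : ∀ n, q.1 ∘ₗ φ n ∈ homDeg F N n := fun n => by
    simpa using comp_mem_homDeg q.2.1 (hφ n).1
  -- Comparing degrees reduces a sum of maps to the injectivity statement in each single degree.
  have key : ∀ n, q.1 ∘ₗ φ n = ψ n := by
    refine eq_of_sum_homDeg_eq (f := φ.mapRange (fun f => q.1 ∘ₗ f) (LinearMap.comp_zero _))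
      (g := ψ) hqφ (fun n => nullHomotopic_le_homDeg F N n (hψ n)) ?_
    rw [hψφ, Finsupp.sum_mapRange_index (fun _ => rfl)]
    ext x
    simp [Finsupp.sum, LinearMap.sum_apply]
  refine Submodule.sum_mem _ fun n _ => Submodule.mem_iSup_of_mem n ?_
  exact hF.mem_nullHomotopic hq (hφ n) (by rw [key]; exact hψ n)

theorem HHom.mk_eq_iff {f g : cycles M N} :
    HHom.mk M N f = HHom.mk M N g ↔ f.1 - g.1 ∈ boundaries M N :=
  Submodule.Quotient.eq _

end SemifreeHom

end DGModule

namespace DGAlgebra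

variable {k : Type u} [Field k] {Λ : DGAlgebra.{u, v} k} {c : ℕ}

/-! ### Contractions on the exterior algebra -/

section Exterior

variable (e : ExteriorAlgebra k (Fin c → k) ≃ₐ[k] Λ.carrier)

/-- The generators of the exterior algebra. -/
def xi (i : Fin c) : Λ.carrier := e (ExteriorAlgebra.ι k (Pi.single i 1))

/-- Contraction with the `i`-th coordinate function. -/
noncomputable def contraction (i : Fin c) : Λ.carrier →ₗ[k] Λ.carrier :=
  e.toLinearMap ∘ₗ CliffordAlgebra.contractLeft (LinearMap.proj i) ∘ₗ e.symm.toLinearMap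

theorem exterior_induction {motive : Λ.carrier → Prop}
    (algebraMap : ∀ r : k, motive (algebraMap k Λ.carrier r))
    (add : ∀ x y, motive x → motive y → motive (x + y))
    (xi_mul : ∀ i x, motive x → motive (xi e i * x)) (a : Λ.carrier) : motive a := by
  have h0 : motive 0 := by simpa using algebraMap 0
  -- The motive is not assumed stable under scalars, so the claim is strengthened to all multiples.
  suffices h : ∀ x : ExteriorAlgebra k (Fin c → k), ∀ r : k, motive (r • e x) by
    simpa using h (e.symm a) 1
  intro x
  induction x using CliffordAlgebra.left_induction with
  | algebraMap s =>
    intro r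
    rw [AlgEquiv.commutes, Algebra.smul_def, ← map_mul]
    exact algebraMap _
  | add x y hx hy =>
    intro r
    rw [map_add, smul_add]
    exact add _ _ (hx r) (hy r)
  | ι_mul x m hx =>
    intro r
    have hm : m = ∑ i, m i • (Pi.single i (1 : k) : Fin c → k) := by
      ext j
      simp [Finset.sum_apply, Pi.single_apply]
    have hsum : r • e (CliffordAlgebra.ι 0 m * x) = ∑ i, xi e i * ((r * m i) • e x) := by
      conv_lhs => rw [hm]
      simp only [map_mul, map_sum, map_smul, Finset.sum_mul, Finset.smul_sum, mul_smul_comm,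
        smul_mul_assoc, smul_smul]
      rfl
    rw [hsum]
    exact Finset.sum_induction _ motive add h0 fun i _ => xi_mul i _ (hx _)

theorem xi_mul_self (i : Fin c) : xi e i * xi e i = 0 := by
  rw [xi, ← map_mul, ExteriorAlgebra.ι_sq_zero, map_zero]

theorem xi_mul_xi (i j : Fin c) : xi e i * xi e j = -(xi e j * xi e i) := by
  rw [eq_neg_iff_add_eq_zero, xi, xi, ← map_mul e, ← map_mul e, ← map_add e,
    ExteriorAlgebra.ι_add_mul_swap, map_zero]

theorem contraction_xi_mul_self (i : Fin c) (a : Λ.carrier) :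
    contraction e i (xi e i * a) = a - xi e i * contraction e i a := by
  simp only [contraction, xi, LinearMap.comp_apply, AlgEquiv.toLinearMap_apply, map_mul,
    AlgEquiv.symm_apply_apply]
  erw [CliffordAlgebra.contractLeft_ι_mul]
  simp

theorem contraction_xi_mul_of_ne {i j : Fin c} (h : i ≠ j) (a : Λ.carrier) :
    contraction e i (xi e j * a) = -(xi e j * contraction e i a) := by
  simp only [contraction, xi, LinearMap.comp_apply, AlgEquiv.toLinearMap_apply, map_mul,
    AlgEquiv.symm_apply_apply]
  erw [CliffordAlgebra.contractLeft_ι_mul]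
  simp [h]

theorem contraction_algebraMap (i : Fin c) (r : k) :
    contraction e i (algebraMap k Λ.carrier r) = 0 := by
  simp [contraction]

theorem exteriorAugmentation_xi_mul (i : Fin c) (a : Λ.carrier) :
    exteriorAugmentation e (xi e i * a) = 0 := by
  rw [map_mul]
  simp [exteriorAugmentation, xi, ExteriorAlgebra.algebraMapInv]

/-- An element fixed by all `∂ᵢ ξᵢ` is a scalar. -/
theorem eq_algebraMap_of_contraction {a : Λ.carrier}
    (ha : ∀ i, contraction e i (xi e i * a) = a) :
    a = algebraMap k Λ.carrier (exteriorAugmentation e a) := by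
  -- The composite of the operators ∂ᵢξᵢ over a list. Over all indices it fixes scalars and kills
  -- every ξⱼΛ, so it is the augmentation.
  let E : List (Fin c) → Λ.carrier → Λ.carrier :=
    fun l x => l.foldr (fun i y => contraction e i (xi e i * y)) x
  have hfix : ∀ l, ∀ x, (∀ i, contraction e i (xi e i * x) = x) → E l x = x := by
    intro l x hx
    induction l with
    | nil => rfl
    | cons i l ih => exact (congrArg (fun y => contraction e i (xi e i * y)) ih).trans (hx i)
  have hadd : ∀ l x y, E l (x + y) = E l x + E l y := by
    intro l x y
    induction l with
    | nil => rfl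
    | cons i l ih =>
      change contraction e i (xi e i * E l (x + y)) = _
      rw [ih, mul_add, map_add]
      rfl
  have hrange : ∀ l j x, ∃ y, E l (xi e j * x) = xi e j * y ∧ (j ∈ l → y = 0) := by
    intro l j x
    induction l with
    | nil => exact ⟨x, rfl, by simp⟩
    | cons i l ih =>
      obtain ⟨y, hy, hy0⟩ := ih
      have hE : E (i :: l) (xi e j * x) = contraction e i (xi e i * (xi e j * y)) :=
        congrArg (fun y => contraction e i (xi e i * y)) hy
      by_cases hij : i = j
      · subst hij
        refine ⟨0, ?_, fun _ => rfl⟩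
        rw [hE, ← mul_assoc, xi_mul_self, zero_mul, map_zero, mul_zero]
      · refine ⟨contraction e i (xi e i * y), ?_, fun hj => ?_⟩
        · rw [hE, ← mul_assoc, xi_mul_xi, neg_mul, map_neg, mul_assoc,
            contraction_xi_mul_of_ne e hij, neg_neg]
        · rw [hy0 ((List.mem_cons.mp hj).resolve_left (Ne.symm hij)), mul_zero, map_zero]
  have key : ∀ x, E (List.finRange c) x = algebraMap k Λ.carrier (exteriorAugmentation e x) := by
    intro x
    induction x using exterior_induction e with
    | algebraMap r =>
      rw [AlgHom.commutes]
      refine hfix _ _ fun i => ?_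
      rw [contraction_xi_mul_self, contraction_algebraMap, mul_zero, sub_zero]
    | add x y hx hy => rw [hadd, hx, hy, map_add, map_add]
    | xi_mul i x _ =>
      obtain ⟨y, hy, hy0⟩ := hrange (List.finRange c) i x
      rw [hy, hy0 (List.mem_finRange i), mul_zero, exteriorAugmentation_xi_mul, map_zero]
  rw [← key, hfix _ _ ha]

variable {e} {deg : Fin c → ℤ}

/-- All ξⱼ have odd degree, so the degree of a product of generators has the parity of its length.
Hence anticommutation of the generators gives the sign (-1)ⁿ. -/
theorem xi_mul_of_mem (he : ∀ i, xi e i ∈ Λ.gr (deg i)) (hodd : ∀ i, Odd (deg i)) {n : ℤ}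
    {a : Λ.carrier} (ha : a ∈ Λ.gr n) (i : Fin c) :
    xi e i * a = n.negOnePow • (a * xi e i) := by
  suffices h : ∀ a : Λ.carrier, ∀ n : ℤ, xi e i * (DirectSum.decompose Λ.gr a n : Λ.carrier) =
      n.negOnePow • ((DirectSum.decompose Λ.gr a n : Λ.carrier) * xi e i) by
    have := h a n
    rwa [DirectSum.decompose_of_mem_same _ ha] at this
  intro a
  induction a using exterior_induction e with
  | algebraMap r =>
    intro n
    have hr : algebraMap k Λ.carrier r ∈ Λ.gr 0 := SetLike.algebraMap_mem_graded Λ.gr r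
    by_cases hn : 0 = n
    · subst hn
      rw [DirectSum.decompose_of_mem_same _ hr, Int.negOnePow_zero, one_smul, Algebra.commutes]
    · rw [DirectSum.decompose_of_mem_ne _ hr hn, mul_zero, zero_mul, smul_zero]
  | add x y hx hy =>
    intro n
    simp only [DirectSum.decompose_add, DirectSum.add_apply, Submodule.coe_add, mul_add, add_mul,
      hx n, hy n, smul_add]
  | xi_mul j x hx =>
    intro n
    obtain ⟨m, rfl⟩ : ∃ m, n = deg j + m := ⟨n - deg j, by ring⟩
    rw [DirectSum.coe_decompose_mul_add_of_left_mem Λ.gr (he j), ← mul_assoc, xi_mul_xi, neg_mul,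
      mul_assoc, hx m, Int.negOnePow_add, Int.negOnePow_odd _ (hodd j), mul_smul_comm, mul_assoc]
    simp

end Exterior

/-! ### Construction of the Koszul resolution -/

section Resolution

open DGModule

variable (e : ExteriorAlgebra k (Fin c → k) ≃ₐ[k] Λ.carrier) (deg : Fin c → ℤ)

/-- The free module on the divided power monomials, indexed by their exponents. -/
abbrev Koszul (Λ : DGAlgebra.{u, v} k) (c : ℕ) : Type v := (Fin c →₀ ℕ) →₀ Λ.carrier

/-- The degree of a divided power monomial. -/
noncomputable def monomialDeg : (Fin c →₀ ℕ) →+ ℤ := Finsupp.weight fun i => deg i + 1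

theorem monomialDeg_single (i : Fin c) : monomialDeg deg (Finsupp.single i 1) = deg i + 1 := by
  simp [monomialDeg, Finsupp.weight_single]

/-- Division by a divided power monomial: the action of a monomial in the `χᵢ`. -/
noncomputable def shift (a : Fin c →₀ ℕ) : Koszul Λ c →ₗ[k] Koszul Λ c :=
  Finsupp.lcomapDomain (· + a) (add_left_injective a)

theorem shift_apply (a : Fin c →₀ ℕ) (f : Koszul Λ c) (b : Fin c →₀ ℕ) :
    shift a f b = f (b + a) := rfl

/-- The Koszul differential `∑ᵢ ξᵢ χᵢ`. -/
noncomputable def koszulD : Koszul Λ c →ₗ[k] Koszul Λ c :=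
  ∑ i, Finsupp.mapRange.linearMap (LinearMap.mulLeft k (xi e i)) ∘ₗ
    shift (Finsupp.single i 1)

theorem koszulD_apply (f : Koszul Λ c) (b : Fin c →₀ ℕ) :
    koszulD e f b = ∑ i, xi e i * f (b + Finsupp.single i 1) := by
  simp only [koszulD, LinearMap.sum_apply, Finsupp.finsetSum_apply]
  rfl

/-- The grading of the Koszul resolution. -/
noncomputable def koszulGr (Λ : DGAlgebra.{u, v} k) (n : ℤ) : Submodule k (Koszul Λ c) where
  carrier := {f | ∀ b, f b ∈ Λ.gr (n - monomialDeg deg b)}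
  zero_mem' _ := zero_mem _
  add_mem' hf hg b := add_mem (hf b) (hg b)
  smul_mem' r _ hf b := Submodule.smul_mem _ r (hf b)

theorem single_mem_koszulGr {n : ℤ} {a : Λ.carrier} (ha : a ∈ Λ.gr n) (b : Fin c →₀ ℕ) :
    (Finsupp.single b a : Koszul Λ c) ∈ koszulGr deg Λ (n + monomialDeg deg b) := by
  classical
  intro b'
  rw [Finsupp.single_apply]
  split_ifs with h
  · subst h
    rwa [add_sub_cancel_right]
  · exact zero_mem _

theorem isInternal_koszulGr (Λ : DGAlgebra.{u, v} k) :
    DirectSum.IsInternal (koszulGr deg Λ) := by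
  constructor
  -- Homogeneous components are recovered coefficient by coefficient from the grading of Λ, which
  -- gives injectivity.
  · have key : ∀ (x : DirectSum ℤ fun n => koszulGr deg Λ n) (n : ℤ) (b : Fin c →₀ ℕ),
        (DirectSum.decompose Λ.gr (DirectSum.coeAddMonoidHom (koszulGr deg Λ) x b)
          (n - monomialDeg deg b) : Λ.carrier) = (x n).1 b := by
      intro x n b
      induction x using DirectSum.induction_on with
      | zero => simp
      | of m x =>
        rw [DirectSum.coeAddMonoidHom_of]
        by_cases h : m = n
        · subst h
          rw [DirectSum.decompose_of_mem_same _ (x.2 b), DirectSum.of_eq_same]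
        · rw [DirectSum.decompose_of_mem_ne _ (x.2 b) (by simpa using h),
            DirectSum.of_eq_of_ne _ _ _ (Ne.symm h)]
          rfl
      | add x y hx hy =>
        rw [map_add, Finsupp.add_apply, DirectSum.decompose_add, DirectSum.add_apply,
          DirectSum.add_apply, Submodule.coe_add, hx, hy]
        rfl
    intro x y hxy
    refine DFinsupp.ext fun n => Subtype.ext (Finsupp.ext fun b => ?_)
    rw [← key x n b, hxy, key y n b]
  · intro f
    induction f using Finsupp.induction_linear with
    | zero => exact ⟨0, map_zero _⟩
    | add f g hf hg =>
      obtain ⟨x, rfl⟩ := hf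
      obtain ⟨y, rfl⟩ := hg
      exact ⟨x + y, map_add _ _ _⟩
    | single b a =>
      induction a using DirectSum.Decomposition.inductionOn Λ.gr with
      | zero => exact ⟨0, by simp⟩
      | @homogeneous n a =>
        exact ⟨DirectSum.of (fun n => koszulGr deg Λ n) _ ⟨_, single_mem_koszulGr deg a.2 b⟩,
          DirectSum.coeAddMonoidHom_of _ _ _⟩
      | add a a' ha ha' =>
        obtain ⟨x, hx⟩ := ha
        obtain ⟨y, hy⟩ := ha'
        exact ⟨x + y, by rw [map_add, hx, hy, Finsupp.single_add]⟩

/-- The ξᵢ anticommute while lowering exponents commutes, so the terms (i, j) and (j, i) cancel.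
Diagonal terms need ξᵢ² = 0, which anticommutation does not give in characteristic 2. -/
theorem koszulD_koszulD (f : Koszul Λ c) : koszulD e (koszulD e f) = 0 := by
  ext b
  simp only [koszulD_apply, Finset.mul_sum, ← mul_assoc, Finsupp.zero_apply]
  rw [← Finset.sum_product']
  refine Finset.sum_involution (fun p _ => p.swap) ?_ ?_ (fun _ _ => Finset.mem_univ _)
    (fun p _ => Prod.swap_swap p)
  · rintro ⟨i, j⟩ -
    rw [xi_mul_xi e (i, j).1, add_right_comm b]
    simp
  · rintro ⟨i, j⟩ - hne heq
    obtain rfl : j = i := congrArg Prod.fst heq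
    exact hne (by simp [xi_mul_self])

noncomputable instance koszulDecomposition (Λ : DGAlgebra.{u, v} k) :
    DirectSum.Decomposition (koszulGr deg Λ) :=
  (isInternal_koszulGr deg Λ).chooseDecomposition

variable {e deg}

/-- The Koszul resolution: `d` acts on divided power monomials by `y⁽ᵃ⁾ ↦ ∑ᵢ ξᵢ y⁽ᵃ⁻ᵉⁱ⁾`. -/
noncomputable def koszul (he : ∀ i, xi e i ∈ Λ.gr (deg i)) (hodd : ∀ i, Odd (deg i))
    (hd : Λ.d = 0) : DGModule.{u, v, v} Λ where
  carrier := Koszul Λ c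
  gr := koszulGr deg Λ
  smul_mem := fun m n a x ha hx b => by
    have := SetLike.mul_mem_graded ha (hx b)
    rwa [← add_sub_assoc] at this
  d := koszulD e
  d_mem := fun n x hx b => by
    rw [koszulD_apply]
    refine Submodule.sum_mem _ fun i _ => ?_
    have := SetLike.mul_mem_graded (he i) (hx (b + Finsupp.single i 1))
    rw [map_add, monomialDeg_single] at this
    convert this using 2
    ring
  d_d := koszulD_koszulD e
  leibniz := fun n a x ha => by
    ext b
    rw [hd, LinearMap.zero_apply, zero_smul, zero_add]
    change koszulD e (a • x) b = n.negOnePow • (a * koszulD e x b)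
    rw [koszulD_apply, koszulD_apply, Finset.mul_sum, Finset.smul_sum]
    refine Finset.sum_congr rfl fun i _ => ?_
    rw [Finsupp.smul_apply, smul_eq_mul, ← mul_assoc, xi_mul_of_mem he hodd ha, smul_mul_assoc,
      mul_assoc]

end Resolution

end DGAlgebra

namespace DGAlgebra

variable {k : Type u} [Field k] {Λ : DGAlgebra.{u, v} k} {c : ℕ}

/-! ### Semifreeness and acyclicity of the Koszul resolution -/

section KoszulResolution

open DGModule

variable {e : ExteriorAlgebra k (Fin c → k) ≃ₐ[k] Λ.carrier} {deg : Fin c → ℤ}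

theorem decompose_koszulGr_apply (x : Koszul Λ c) (n : ℤ) (b : Fin c →₀ ℕ) :
    (DirectSum.decompose (koszulGr deg Λ) x n).1 b =
      DirectSum.decompose Λ.gr (x b) (n - monomialDeg deg b) := by
  induction x using DirectSum.Decomposition.inductionOn (koszulGr deg Λ) with
  | zero => simp
  | @homogeneous m x =>
    have hx : x.1 b ∈ Λ.gr (m - monomialDeg deg b) := x.2 b
    by_cases h : m = n
    · subst h
      rw [DirectSum.decompose_of_mem_same _ x.2, DirectSum.decompose_of_mem_same _ hx]
    · rw [DirectSum.decompose_of_mem_ne _ x.2 h,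
        DirectSum.decompose_of_mem_ne _ hx (by simpa using h), Finsupp.zero_apply]
  | add x y hx hy =>
    rw [DirectSum.decompose_add, DirectSum.add_apply, Submodule.coe_add, Finsupp.add_apply, hx, hy,
      Finsupp.add_apply, DirectSum.decompose_add, DirectSum.add_apply, Submodule.coe_add]

/-- The filtration of the Koszul resolution by the number of divided power variables. -/
def koszulFil (Λ : DGAlgebra.{u, v} k) (c n : ℕ) : Submodule Λ.carrier (Koszul Λ c) where
  carrier := {f | ∀ b, n ≤ b.degree → f b = 0}
  zero_mem' _ _ := rfl
  add_mem' {f g} hf hg b hb := by rw [Finsupp.add_apply, hf b hb, hg b hb, add_zero]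
  smul_mem' a f hf b hb := by rw [Finsupp.smul_apply, hf b hb, smul_zero]

theorem single_mem_koszulFil {n : ℕ} {b : Fin c →₀ ℕ} (hb : b.degree < n) (a : Λ.carrier) :
    (Finsupp.single b a : Koszul Λ c) ∈ koszulFil Λ c n := by
  intro b' hb'
  rw [Finsupp.single_eq_of_ne]
  rintro rfl
  omega

theorem koszulFil_mono : Monotone (koszulFil Λ c) := fun _ _ hmn _ hf b hb => hf b (hmn.trans hb)

/-- Each term of d lowers one exponent by one, so the monomials become cycles in the graded pieces.
-/
theorem koszulD_mem_koszulFil {n : ℕ} {f : Koszul Λ c} (hf : f ∈ koszulFil Λ c (n + 1)) :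
    koszulD e f ∈ koszulFil Λ c n := by
  intro b hb
  rw [koszulD_apply]
  refine Finset.sum_eq_zero fun i _ => ?_
  rw [hf _ (by rw [map_add, Finsupp.degree_single]; omega), mul_zero]

theorem koszulFil_zero : koszulFil Λ c 0 = ⊥ :=
  eq_bot_iff.mpr fun _ hf => Finsupp.ext fun b => hf b (Nat.zero_le _)

theorem exists_mem_koszulFil (f : Koszul Λ c) : ∃ n, f ∈ koszulFil Λ c n := by
  refine ⟨f.support.sup Finsupp.degree + 1, fun b hb => ?_⟩
  by_contra hne
  have := Finset.le_sup (f := Finsupp.degree) (Finsupp.mem_support_iff.mpr hne)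
  omega

variable (Λ) in
/-- The divided power monomials in `n` variables, as elements of the Koszul resolution. -/
noncomputable def koszulMonomial (n : ℕ) (j : ULift.{v} {b : Fin c →₀ ℕ // b.degree = n}) :
    Koszul Λ c :=
  Finsupp.single j.down.1 1

theorem koszulMonomial_mem_koszulFil (n : ℕ) (j : ULift.{v} {b : Fin c →₀ ℕ // b.degree = n}) :
    koszulMonomial Λ n j ∈ koszulFil Λ c (n + 1) :=
  single_mem_koszulFil (by rw [j.down.2]; exact n.lt_succ_self) 1

theorem linearIndependent_koszulMonomial (n : ℕ) :
    LinearIndependent Λ.carrier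
      fun j => (koszulFil Λ c n).mkQ (koszulMonomial Λ n j) := by
  rw [linearIndependent_iff]
  intro l hl
  have hlc : ∀ (l : ULift.{v} {b : Fin c →₀ ℕ // b.degree = n} →₀ Λ.carrier) j,
      Finsupp.linearCombination Λ.carrier (koszulMonomial Λ n) l j.down.1 = l j := by
    intro l j
    induction l using Finsupp.induction_linear with
    | zero => simp
    | add f g hf hg => rw [map_add, Finsupp.add_apply, hf, hg, Finsupp.add_apply]
    | single i a =>
      rw [Finsupp.linearCombination_single]
      by_cases h : i = j
      · subst h
        simp [koszulMonomial]
      · have h' : j.down.1 ≠ i.down.1 := fun h' => h (ULift.ext _ _ (Subtype.ext h'.symm))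
        rw [koszulMonomial, Finsupp.smul_apply, Finsupp.single_eq_of_ne h',
          Finsupp.single_eq_of_ne (Ne.symm h), smul_zero]
  have hmem : Finsupp.linearCombination Λ.carrier (koszulMonomial Λ n) l ∈ koszulFil Λ c n := by
    rw [← Submodule.ker_mkQ (koszulFil Λ c n), LinearMap.mem_ker, ← hl,
      Finsupp.apply_linearCombination]
    rfl
  ext j
  rw [← hlc l j, hmem _ j.down.2.ge, Finsupp.zero_apply]

theorem koszulFil_sup_span (n : ℕ) :
    koszulFil Λ c n ⊔ Submodule.span Λ.carrier (Set.range (koszulMonomial Λ n)) =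
      koszulFil Λ c (n + 1) := by
  refine le_antisymm (sup_le (koszulFil_mono n.le_succ) (Submodule.span_le.mpr ?_)) ?_
  · rintro _ ⟨j, rfl⟩
    exact koszulMonomial_mem_koszulFil n j
  · intro f hf
    rw [← Finsupp.sum_single f]
    refine Submodule.sum_mem _ fun b hb => ?_
    rcases lt_or_ge b.degree n with h | h
    · exact Submodule.mem_sup_left (single_mem_koszulFil h _)
    · have hbn : b.degree = n := by
        by_contra hne
        exact Finsupp.mem_support_iff.mp hb (hf b (by omega))
      refine Submodule.mem_sup_right ?_
      have := Submodule.smul_mem (Submodule.span Λ.carrier (Set.range (koszulMonomial Λ n))) (f b)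
        (Submodule.subset_span ⟨ULift.up ⟨b, hbn⟩, rfl⟩)
      simpa [koszulMonomial] using this

theorem isSemifree_koszul (he : ∀ i, xi e i ∈ Λ.gr (deg i)) (hodd : ∀ i, Odd (deg i))
    (hd : Λ.d = 0) : (koszul he hodd hd).IsSemifree := by
  refine ⟨koszulFil Λ c, koszulFil_zero, koszulFil_mono, exists_mem_koszulFil,
    fun n => ⟨fun (x : Koszul Λ c) hx m b hb => ?_,
      fun x hx => koszulD_mem_koszulFil (koszulFil_mono n.le_succ hx)⟩,
    fun n => ⟨_, koszulMonomial Λ n,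
      fun j => ⟨_, single_mem_koszulGr deg (SetLike.one_mem_graded Λ.gr) _⟩,
      fun j => koszulD_mem_koszulFil (koszulMonomial_mem_koszulFil n j),
      linearIndependent_koszulMonomial n, koszulFil_sup_span n⟩⟩
  refine (decompose_koszulGr_apply x m b).trans ?_
  rw [hx b hb, DirectSum.decompose_zero]
  rfl

theorem contraction_contraction (i j : Fin c) (a : Λ.carrier) :
    contraction e i (contraction e j a) = -contraction e j (contraction e i a) := by
  simp only [contraction, LinearMap.comp_apply, AlgEquiv.toLinearMap_apply,
    AlgEquiv.symm_apply_apply]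
  rw [CliffordAlgebra.contractLeft_comm, map_neg]

theorem contraction_xi_idem (i : Fin c) (a : Λ.carrier) :
    contraction e i (xi e i * contraction e i (xi e i * a)) = contraction e i (xi e i * a) := by
  rw [contraction_xi_mul_self e i a, mul_sub, ← mul_assoc (xi e i) (xi e i), xi_mul_self, zero_mul,
    sub_zero, contraction_xi_mul_self]

/-- The operator ∂ᵢξᵢ projects onto the elements free of ξᵢ. Commutation ensures that eliminating a
new variable does not bring back an earlier one. -/
theorem contraction_xi_comm {i j : Fin c} (h : i ≠ j) (a : Λ.carrier) :
    contraction e j (xi e j * contraction e i (xi e i * a)) =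
      contraction e i (xi e i * contraction e j (xi e j * a)) := by
  have h₁ : xi e j * contraction e i (xi e i * a) = -contraction e i (xi e j * (xi e i * a)) := by
    rw [contraction_xi_mul_of_ne e h, neg_neg]
  have h₂ : xi e i * contraction e j (xi e j * a) = -contraction e j (xi e i * (xi e j * a)) := by
    rw [contraction_xi_mul_of_ne e h.symm, neg_neg]
  rw [h₁, h₂, ← mul_assoc, xi_mul_xi, neg_mul, map_neg, map_neg, map_neg, map_neg,
    contraction_contraction, neg_neg, mul_assoc]

variable (e) in
/-- The homotopy on the Koszul resolution contracting the `i`-th variable. -/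
noncomputable def koszulHomotopy (i : Fin c) : Koszul Λ c →ₗ[k] Koszul Λ c :=
  Finsupp.mapRange.linearMap (contraction e i) ∘ₗ
    Finsupp.lmapDomain Λ.carrier k (· + Finsupp.single i 1)

theorem koszulHomotopy_apply_add (i : Fin c) (f : Koszul Λ c) (b : Fin c →₀ ℕ) :
    koszulHomotopy e i f (b + Finsupp.single i 1) = contraction e i (f b) := by
  simp only [koszulHomotopy, LinearMap.comp_apply, Finsupp.mapRange.linearMap_apply,
    Finsupp.mapRange_apply, Finsupp.lmapDomain_apply]
  exact congrArg _ (Finsupp.mapDomain_apply (add_left_injective (Finsupp.single i 1)) f b)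

theorem koszulHomotopy_apply_of_eq_zero {i : Fin c} (f : Koszul Λ c) {b : Fin c →₀ ℕ}
    (hb : b i = 0) : koszulHomotopy e i f b = 0 := by
  simp only [koszulHomotopy, LinearMap.comp_apply, Finsupp.mapRange.linearMap_apply,
    Finsupp.mapRange_apply, Finsupp.lmapDomain_apply]
  rw [Finsupp.mapDomain_of_notMem_range, map_zero]
  rintro ⟨b', rfl⟩
  simp at hb

theorem exists_eq_add_single {i : Fin c} {b : Fin c →₀ ℕ} (hb : b i ≠ 0) :
    ∃ b', b = b' + Finsupp.single i 1 := by
  refine ⟨b - Finsupp.single i 1, (tsub_add_cancel_of_le ?_).symm⟩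
  rw [Finsupp.single_le_iff]
  omega

/-- Together with the next lemma this is d hᵢ + hᵢ d = 1 - πᵢ. The factor ∂ᵢξᵢ remains only where yᵢ
is absent, as hᵢ d has no contribution there. -/
theorem koszulHomotopy_of_eq_zero {i : Fin c} (f : Koszul Λ c) {b : Fin c →₀ ℕ} (hb : b i = 0) :
    koszulD e (koszulHomotopy e i f) b + koszulHomotopy e i (koszulD e f) b =
      f b - contraction e i (xi e i * f b) := by
  rw [koszulHomotopy_apply_of_eq_zero _ hb, add_zero, koszulD_apply, Finset.sum_eq_single i,
    koszulHomotopy_apply_add, contraction_xi_mul_self, sub_sub_cancel]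
  · intro j _ hj
    rw [koszulHomotopy_apply_of_eq_zero, mul_zero]
    simp [hb, hj]
  · simp

theorem koszulHomotopy_of_ne_zero {i : Fin c} (f : Koszul Λ c) {b : Fin c →₀ ℕ} (hb : b i ≠ 0) :
    koszulD e (koszulHomotopy e i f) b + koszulHomotopy e i (koszulD e f) b = f b := by
  obtain ⟨b, rfl⟩ := exists_eq_add_single hb
  rw [koszulHomotopy_apply_add, koszulD_apply, koszulD_apply, map_sum, ← Finset.sum_add_distrib,
    Finset.sum_eq_single i]
  · rw [koszulHomotopy_apply_add, contraction_xi_mul_self, add_sub_cancel]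
  · intro j _ hj
    rw [add_right_comm, koszulHomotopy_apply_add, contraction_xi_mul_of_ne e (Ne.symm hj),
      add_neg_cancel]
  · simp

/-- Every cycle of the Koszul resolution is homologous to a scalar. -/
theorem exists_koszul_sub_eq {z : Koszul Λ c} (hz : koszulD e z = 0) :
    ∃ y, z - koszulD e y =
      Finsupp.single 0 (algebraMap k Λ.carrier (exteriorAugmentation e (z 0))) := by
  classical
  -- Modulo boundaries, z can be made free of ξᵢ and yᵢ for all i in T; each new index costs one
  -- application of the homotopy to the cycle reached so far.
  have key : ∀ T : Finset (Fin c), ∃ y, ∀ i ∈ T, ∀ b,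
      (b i ≠ 0 → (z - koszulD e y) b = 0) ∧
        contraction e i (xi e i * (z - koszulD e y) b) = (z - koszulD e y) b := by
    intro T
    induction T using Finset.induction_on with
    | empty => exact ⟨0, by simp⟩
    | insert i T hi ih =>
      obtain ⟨y, hy⟩ := ih
      set x := z - koszulD e y with hx
      have hdx : koszulD e x = 0 := by rw [hx, map_sub, hz, koszulD_koszulD, sub_zero]
      have hx' : z - koszulD e (y + koszulHomotopy e i x) =
          x - koszulD e (koszulHomotopy e i x) := by
        rw [map_add, ← sub_sub]
      have h₀ : ∀ b : Fin c →₀ ℕ, b i = 0 →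
          (x - koszulD e (koszulHomotopy e i x)) b = contraction e i (xi e i * x b) := by
        intro b hb
        have := koszulHomotopy_of_eq_zero (e := e) x hb
        rw [hdx, map_zero, Finsupp.zero_apply, add_zero] at this
        rw [Finsupp.sub_apply, this, sub_sub_cancel]
      have h₁ : ∀ b : Fin c →₀ ℕ, b i ≠ 0 → (x - koszulD e (koszulHomotopy e i x)) b = 0 := by
        intro b hb
        have := koszulHomotopy_of_ne_zero (e := e) x hb
        rw [hdx, map_zero, Finsupp.zero_apply, add_zero] at this
        rw [Finsupp.sub_apply, this, sub_self]
      refine ⟨y + koszulHomotopy e i x, fun j hj b => ?_⟩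
      rw [hx']
      by_cases hb : b i = 0
      · rw [h₀ b hb]
        rcases Finset.mem_insert.mp hj with rfl | hj
        · exact ⟨fun h => absurd hb h, contraction_xi_idem _ _⟩
        · refine ⟨fun h => by rw [(hy j hj b).1 h, mul_zero, map_zero], ?_⟩
          rw [contraction_xi_comm (by rintro rfl; exact hi hj), (hy j hj b).2]
      · rw [h₁ b hb, mul_zero, map_zero]
        exact ⟨fun _ => rfl, rfl⟩
  obtain ⟨y, hy⟩ := key Finset.univ
  refine ⟨y, Finsupp.ext fun b => ?_⟩
  by_cases hb : b = 0
  · subst hb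
    rw [Finsupp.single_eq_same, eq_algebraMap_of_contraction e fun i => (hy i (by simp) 0).2,
      Finsupp.sub_apply, map_sub, koszulD_apply, map_sum]
    simp only [exteriorAugmentation_xi_mul, Finset.sum_const_zero, sub_zero]
  · rw [Finsupp.single_eq_of_ne hb]
    obtain ⟨i, hi⟩ := Finsupp.ne_iff.mp hb
    exact (hy i (by simp) b).1 hi

variable (e) in
/-- The augmentation of the Koszul resolution. -/
noncomputable def koszulAugmentation : Koszul Λ c →ₗ[k] k :=
  (exteriorAugmentation e).toLinearMap ∘ₗ Finsupp.lapply 0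

theorem koszulAugmentation_apply (f : Koszul Λ c) :
    koszulAugmentation e f = exteriorAugmentation e (f 0) := rfl

theorem koszulAugmentation_koszulD (f : Koszul Λ c) :
    koszulAugmentation e (koszulD e f) = 0 := by
  rw [koszulAugmentation_apply, koszulD_apply, map_sum]
  exact Finset.sum_eq_zero fun i _ => exteriorAugmentation_xi_mul e i _

theorem koszulAugmentation_mem_chainMaps (he : ∀ i, xi e i ∈ Λ.gr (deg i))
    (hpos : ∀ i, 0 < deg i) (hodd : ∀ i, Odd (deg i)) (hd : Λ.d = 0) :
    koszulAugmentation e ∈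
      chainMaps (koszul he hodd hd) (Λ.residueModule e he hpos hd) 0 := by
  refine ⟨⟨fun i (x : Koszul Λ c) hx => ?_, fun j a (x : Koszul Λ c) _ => ?_⟩, ?_⟩
  · change exteriorAugmentation e (x 0) ∈ trivialGr k (i + 0)
    rw [add_zero]
    by_cases hi : i = 0
    · subst hi
      exact mem_trivialGr_zero _
    · have hx0 : x 0 ∈ Λ.gr i := by simpa using hx 0
      rw [exteriorAugmentation_eq_zero e he hpos i _ hi hx0]
      exact zero_mem _
  · change exteriorAugmentation e (a * x 0) =
      (0 * j).negOnePow • (exteriorAugmentation e a * exteriorAugmentation e (x 0))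
    simp
  · change homD _ _ 0 _ = 0
    refine LinearMap.ext fun (x : Koszul Λ c) => ?_
    change (0 : k) - (0 : ℤ).negOnePow • koszulAugmentation e (koszulD e x) = 0
    rw [koszulAugmentation_koszulD, smul_zero, sub_zero]

theorem isQuasiIso_koszulAugmentation (he : ∀ i, xi e i ∈ Λ.gr (deg i))
    (hpos : ∀ i, 0 < deg i) (hodd : ∀ i, Odd (deg i)) (hd : Λ.d = 0) :
    IsQuasiIso (⟨koszulAugmentation e, koszulAugmentation_mem_chainMaps he hpos hodd hd⟩ :
      Hom (koszul he hodd hd) (Λ.residueModule e he hpos hd)) := by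
  constructor
  · rw [← LinearMap.ker_eq_bot, LinearMap.ker_eq_bot']
    intro z hz
    obtain ⟨⟨(z : Koszul Λ c), hz'⟩, rfl⟩ := Submodule.Quotient.mk_surjective _ z
    obtain ⟨y, hy⟩ := (Submodule.Quotient.mk_eq_zero _).mp hz
    have hz0 : exteriorAugmentation e (z 0) = 0 := hy.symm
    obtain ⟨x, hx⟩ := exists_koszul_sub_eq (e := e) (z := z) hz'
    rw [hz0, map_zero, Finsupp.single_zero, sub_eq_zero] at hx
    exact (Submodule.Quotient.mk_eq_zero _).mpr ⟨x, hx.symm⟩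
  · intro r
    obtain ⟨⟨(r : k), hr⟩, rfl⟩ := Submodule.Quotient.mk_surjective _ r
    have hcyc : koszulD e (Finsupp.single 0 (algebraMap k Λ.carrier r) : Koszul Λ c) = 0 := by
      ext b
      rw [koszulD_apply]
      refine Finset.sum_eq_zero fun i _ => ?_
      rw [Finsupp.single_eq_of_ne (by simp), mul_zero]
    refine ⟨Submodule.Quotient.mk ⟨(Finsupp.single 0 (algebraMap k Λ.carrier r) : Koszul Λ c),
      hcyc⟩, ?_⟩
    refine congrArg Submodule.Quotient.mk (Subtype.ext ?_)
    change exteriorAugmentation e ((Finsupp.single 0 (algebraMap k Λ.carrier r) : Koszul Λ c) 0) = r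
    rw [Finsupp.single_eq_same, AlgHom.commutes]
    rfl

/-- The Koszul resolution, as a semifree resolution. -/
noncomputable def koszulResolution (he : ∀ i, xi e i ∈ Λ.gr (deg i))
    (hpos : ∀ i, 0 < deg i) (hodd : ∀ i, Odd (deg i)) (hd : Λ.d = 0) :
    SemifreeResolution.{u, v, v, u} (Λ.residueModule e he hpos hd) where
  F := koszul he hodd hd
  semifree := isSemifree_koszul he hodd hd
  ε := ⟨koszulAugmentation e, koszulAugmentation_mem_chainMaps he hpos hodd hd⟩
  quasiIso := isQuasiIso_koszulAugmentation he hpos hodd hd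

end KoszulResolution

end DGAlgebra

namespace DGModule

/-! ### Comparison of resolutions -/

section Comparison

variable {k : Type u} [CommRing k] {A : DGAlgebra.{u, v} k}

theorem id_mem_chainMaps (M : DGModule.{u, v, w} A) : LinearMap.id ∈ chainMaps M M 0 := by
  refine ⟨⟨fun i x hx => by simpa using hx, fun j a x _ => by simp⟩, ?_⟩
  change homD M M 0 LinearMap.id = 0
  ext x
  simp [homD_apply]

namespace SemifreeResolution

variable {U : DGModule.{u, v, w₁} A}

/-- Comparison of semifree resolutions. -/
theorem exists_comparison (R : SemifreeResolution.{u, v, w, w₁} U)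
    (S : SemifreeResolution.{u, v, w₂, w₁} U) :
    ∃ g ∈ chainMaps R.F S.F 0, R.ε.1 - S.ε.1 ∘ₗ g ∈ boundaries R.F U :=
  R.semifree.exists_chainMap_lift S.quasiIso R.ε.2

/-- Comparison maps are mutually inverse up to homotopy. -/
theorem comparison_comp (R : SemifreeResolution.{u, v, w, w₁} U)
    (S : SemifreeResolution.{u, v, w₂, w₁} U) {g : R.F.carrier →ₗ[k] S.F.carrier}
    {h : S.F.carrier →ₗ[k] R.F.carrier} (hg : g ∈ chainMaps R.F S.F 0)
    (hh : h ∈ chainMaps S.F R.F 0) (hgε : R.ε.1 - S.ε.1 ∘ₗ g ∈ boundaries R.F U)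
    (hhε : S.ε.1 - R.ε.1 ∘ₗ h ∈ boundaries S.F U) :
    LinearMap.id - h ∘ₗ g ∈ boundaries R.F R.F := by
  have hg' := chainMaps_le_cycles _ _ _ hg
  have hh' := chainMaps_le_cycles _ _ _ hh
  -- It is enough to compare after composing with ε, where ε - ε h g = (ε - ε' g) + (ε' - ε h) g,
  -- with ε' the augmentation of S.
  refine R.semifree.mem_boundaries R.quasiIso
    (sub_mem (chainMaps_le_cycles _ _ _ (id_mem_chainMaps _)) (comp_mem_cycles hh' hg')) ?_
  have := add_mem hgε (comp_mem_boundaries_right hhε hg')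
  convert this using 1
  ext x
  simp

end SemifreeResolution

end Comparison

end DGModule

namespace DGAlgebra

variable {k : Type u} [Field k] {Λ : DGAlgebra.{u, v} k} {c : ℕ}

/-! ### Polynomials as chain endomorphisms and as maps to k -/

section PolynomialAction

open DGModule

variable {e : ExteriorAlgebra k (Fin c → k) ≃ₐ[k] Λ.carrier} {deg : Fin c → ℤ}

/-- Polynomials act on the Koszul resolution, with `χᵢ` acting by `y⁽ᵃ⁾ ↦ y⁽ᵃ⁻ᵉⁱ⁾`. -/
noncomputable def polyAction (Λ : DGAlgebra.{u, v} k) :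
    MvPolynomial (Fin c) k →ₐ[k] Module.End k (Koszul Λ c) :=
  AddMonoidAlgebra.lift k _ _
    { toFun := fun a => shift a.toAdd
      map_one' := LinearMap.ext fun f => Finsupp.ext fun b => congrArg f (add_zero b)
      map_mul' := fun a a' => LinearMap.ext fun f => Finsupp.ext fun b => by
        change f (b + (a.toAdd + a'.toAdd)) = f (b + a.toAdd + a'.toAdd)
        rw [add_assoc] }

theorem polyAction_monomial (a : Fin c →₀ ℕ) (r : k) (f : Koszul Λ c) :
    polyAction Λ (MvPolynomial.monomial a r) f = r • shift a f := by
  exact LinearMap.congr_fun (AddMonoidAlgebra.lift_single _ a r) f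

theorem weight_neg_eq (a : Fin c →₀ ℕ) :
    Finsupp.weight (fun i => -(deg i + 1)) a = -monomialDeg deg a := by
  rw [monomialDeg, Finsupp.weight_apply, Finsupp.weight_apply, Finsupp.sum, Finsupp.sum,
    ← Finset.sum_neg_distrib]
  simp only [smul_neg]

theorem even_monomialDeg (hodd : ∀ i, Odd (deg i)) (a : Fin c →₀ ℕ) :
    Even (monomialDeg deg a) := by
  rw [monomialDeg, Finsupp.weight_apply]
  exact Finset.even_sum _ fun i _ => ((hodd i).add_odd odd_one).nsmul_right (a i)

theorem shift_mem_chainMaps (he : ∀ i, xi e i ∈ Λ.gr (deg i)) (hodd : ∀ i, Odd (deg i))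
    (hd : Λ.d = 0) (a : Fin c →₀ ℕ) :
    shift a ∈
      chainMaps (koszul he hodd hd) (koszul he hodd hd) (-monomialDeg deg a) := by
  have heven : Even (-monomialDeg deg a) := (even_monomialDeg hodd a).neg
  refine ⟨⟨fun i (x : Koszul Λ c) hx b => ?_, fun j r (x : Koszul Λ c) _ => ?_⟩, ?_⟩
  · have : x (b + a) ∈ Λ.gr (i - monomialDeg deg (b + a)) := hx (b + a)
    rw [map_add] at this
    change x (b + a) ∈ Λ.gr (i + -monomialDeg deg a - monomialDeg deg b)
    convert this using 2
    ring
  · rw [Int.negOnePow_even _ (heven.mul_right j), one_smul]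
    exact Finsupp.ext fun b => rfl
  · change homD _ _ _ _ = 0
    refine LinearMap.ext fun (x : Koszul Λ c) => ?_
    change koszulD e (shift a x) - (-monomialDeg deg a).negOnePow • shift a (koszulD e x) = 0
    rw [Int.negOnePow_even _ heven, one_smul]
    refine sub_eq_zero.mpr (Finsupp.ext fun b => ?_)
    change koszulD e (shift a x) b = koszulD e x (b + a)
    rw [koszulD_apply, koszulD_apply]
    refine Finset.sum_congr rfl fun i _ => ?_
    rw [shift_apply, add_right_comm]

theorem polyAction_mem_chainMaps (he : ∀ i, xi e i ∈ Λ.gr (deg i)) (hodd : ∀ i, Odd (deg i))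
    (hd : Λ.d = 0) {n : ℤ} {p : MvPolynomial (Fin c) k}
    (hp : p ∈ MvPolynomial.weightedHomogeneousSubmodule k (fun i => -(deg i + 1)) n) :
    polyAction Λ p ∈ chainMaps (koszul he hodd hd) (koszul he hodd hd) n := by
  rw [p.as_sum, map_sum]
  refine Submodule.sum_mem _ fun a ha => ?_
  have hn : -monomialDeg deg a = n := by
    rw [← weight_neg_eq]
    exact hp (MvPolynomial.mem_support_iff.mp ha)
  have : polyAction Λ (MvPolynomial.monomial a (p.coeff a)) =
      p.coeff a • shift a :=
    LinearMap.ext fun f => polyAction_monomial a _ f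
  rw [this, ← hn]
  exact Submodule.smul_mem _ _ (shift_mem_chainMaps he hodd hd a)

theorem polyAction_mem_cycles (he : ∀ i, xi e i ∈ Λ.gr (deg i)) (hodd : ∀ i, Odd (deg i))
    (hd : Λ.d = 0) (p : MvPolynomial (Fin c) k) :
    polyAction Λ p ∈ cycles (koszul he hodd hd) (koszul he hodd hd) := by
  rw [p.as_sum, map_sum]
  refine Submodule.sum_mem _ fun a _ => chainMaps_le_cycles _ _ _
    (polyAction_mem_chainMaps he hodd hd (MvPolynomial.isWeightedHomogeneous_monomial _ a _ rfl))

/-- The monomials χᵇ are thereby dual to the y⁽ᵇ⁾. -/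
theorem koszulAugmentation_polyAction (p : MvPolynomial (Fin c) k) (b : Fin c →₀ ℕ) :
    koszulAugmentation e (polyAction Λ p (Finsupp.single b 1)) = p.coeff b := by
  classical
  induction p using MvPolynomial.induction_on' with
  | monomial a r =>
    rw [polyAction_monomial, map_smul, koszulAugmentation_apply, shift_apply, zero_add,
      MvPolynomial.coeff_monomial, Finsupp.single_apply]
    by_cases h : a = b
    · subst h; simp
    · rw [if_neg h, if_neg (Ne.symm h), map_zero, smul_zero]
  | add p q hp hq => rw [map_add, LinearMap.add_apply, map_add, hp, hq, MvPolynomial.coeff_add]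

section HomToResidue

variable {he : ∀ i, xi e i ∈ Λ.gr (deg i)} {hpos : ∀ i, 0 < deg i} {hodd : ∀ i, Odd (deg i)}
  {hd : Λ.d = 0} {n : ℤ}

/-- Coefficients of nonzero degree act as zero on k, and in degree 0 the sign is trivial. -/
theorem homDeg_apply_single {φ : Koszul Λ c →ₗ[k] k}
    (hφ : φ ∈ homDeg (koszul he hodd hd) (Λ.residueModule e he hpos hd) n) (b : Fin c →₀ ℕ)
    (a : Λ.carrier) :
    φ (Finsupp.single b a) = exteriorAugmentation e a * φ (Finsupp.single b 1) := by
  induction a using DirectSum.Decomposition.inductionOn Λ.gr with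
  | zero => simp
  | @homogeneous j a =>
    have h : φ (a.1 • Finsupp.single b (1 : Λ.carrier)) =
        (n * j).negOnePow • (exteriorAugmentation e a.1 * φ (Finsupp.single b 1)) :=
      hφ.2 j a.1 (Finsupp.single b (1 : Λ.carrier) : Koszul Λ c) a.2
    rw [Finsupp.smul_single, smul_eq_mul, mul_one] at h
    rw [h]
    by_cases hj : j = 0
    · simp [hj]
    · rw [exteriorAugmentation_eq_zero e he hpos j _ hj a.2, zero_mul, smul_zero]
  | add a a' ha ha' => rw [Finsupp.single_add, map_add, ha, ha', map_add, add_mul]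

theorem homDeg_ext {m : ℤ} {φ ψ : Koszul Λ c →ₗ[k] k}
    (hφ : φ ∈ homDeg (koszul he hodd hd) (Λ.residueModule e he hpos hd) n)
    (hψ : ψ ∈ homDeg (koszul he hodd hd) (Λ.residueModule e he hpos hd) m)
    (h : ∀ b, φ (Finsupp.single b 1) = ψ (Finsupp.single b 1)) : φ = ψ := by
  refine Finsupp.lhom_ext fun b a => ?_
  rw [homDeg_apply_single hφ, homDeg_apply_single hψ, h]

theorem homDeg_apply_koszulD {φ : Koszul Λ c →ₗ[k] k}
    (hφ : φ ∈ homDeg (koszul he hodd hd) (Λ.residueModule e he hpos hd) n) (f : Koszul Λ c) :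
    φ (koszulD e f) = 0 := by
  have h : ∀ g : Koszul Λ c, (∀ b, exteriorAugmentation e (g b) = 0) → φ g = 0 := by
    intro g hg
    rw [← Finsupp.sum_single g, Finsupp.sum, map_sum]
    exact Finset.sum_eq_zero fun b _ => by rw [homDeg_apply_single hφ, hg, zero_mul]
  refine h _ fun b => ?_
  rw [koszulD_apply, map_sum]
  exact Finset.sum_eq_zero fun i _ => exteriorAugmentation_xi_mul e i _

theorem boundaries_koszul_eq_bot :
    boundaries (koszul he hodd hd) (Λ.residueModule e he hpos hd) = ⊥ := by
  rw [eq_bot_iff]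
  refine iSup_le fun n => ?_
  rintro _ ⟨φ, hφ, rfl⟩
  refine (Submodule.mem_bot k).mpr (LinearMap.ext fun (x : Koszul Λ c) => ?_)
  change (0 : k) - (n + 1).negOnePow • (show Koszul Λ c →ₗ[k] k from φ) (koszulD e x) = 0
  rw [homDeg_apply_koszulD hφ, smul_zero, sub_zero]

/-- Each yᵢ has degree at least 1, which bounds the total exponent. This finiteness makes Ext in
each degree consist of polynomials rather than infinite series. -/
theorem finite_monomialDeg_eq (hpos : ∀ i, 0 < deg i) (n : ℤ) :
    {b : Fin c →₀ ℕ | monomialDeg deg b = n}.Finite := by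
  refine (Finsupp.finite_of_degree_le n.toNat).subset fun b hb => ?_
  have h : (b.degree : ℤ) ≤ monomialDeg deg b := by
    rw [Finsupp.degree_eq_sum, monomialDeg, Finsupp.weight_apply, Finsupp.sum_fintype _ _ (by simp)]
    push_cast
    refine Finset.sum_le_sum fun i _ => ?_
    rw [nsmul_eq_mul]
    have := hpos i
    nlinarith [(Nat.cast_nonneg (b i) : (0 : ℤ) ≤ b i)]
  rw [Set.mem_ofPred_eq] at hb ⊢
  omega

theorem exists_polyAction_eq {φ : Koszul Λ c →ₗ[k] k}
    (hφ : φ ∈ homDeg (koszul he hodd hd) (Λ.residueModule e he hpos hd) n) :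
    ∃ p ∈ MvPolynomial.weightedHomogeneousSubmodule k (fun i => -(deg i + 1)) n,
      φ = koszulAugmentation e ∘ₗ polyAction Λ p := by
  classical
  let s := (finite_monomialDeg_eq hpos (-n)).toFinset
  have hs : ∀ b, b ∈ s ↔ monomialDeg deg b = -n := fun b => by simp [s]
  -- The coefficient at b is forced to be φ(y⁽ᵇ⁾), which vanishes for degree reasons outside s.
  let p : MvPolynomial (Fin c) k :=
    ∑ b ∈ s, MvPolynomial.monomial b (φ (Finsupp.single b 1))
  have hp : p ∈ MvPolynomial.weightedHomogeneousSubmodule k (fun i => -(deg i + 1)) n := by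
    refine Submodule.sum_mem _ fun b hb => MvPolynomial.isWeightedHomogeneous_monomial _ _ _ ?_
    rw [weight_neg_eq, (hs b).mp hb, neg_neg]
  have hψ := comp_mem_chainMaps (koszulAugmentation_mem_chainMaps he hpos hodd hd)
    (polyAction_mem_chainMaps he hodd hd hp)
  refine ⟨p, hp, homDeg_ext hφ hψ.1 fun b => ?_⟩
  rw [LinearMap.comp_apply]
  refine Eq.trans ?_ (koszulAugmentation_polyAction p b).symm
  simp only [p, MvPolynomial.coeff_sum, MvPolynomial.coeff_monomial, Finset.sum_ite_eq', hs]
  split_ifs with hb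
  · rfl
  · have hb' := hφ.1 _ _ (single_mem_koszulGr deg (SetLike.one_mem_graded Λ.gr) b)
    refine eq_zero_of_mem_trivialGr (fun h => hb ?_) hb'
    omega

end HomToResidue

end PolynomialAction

end DGAlgebra

/-! ### The isomorphism for an arbitrary resolution -/

open DGModule DGAlgebra in
theorem proposition5p1 {k : Type u} [Field k] (Λ : DGAlgebra.{u, v} k) (hd : Λ.d = 0)
    (c : ℕ) (deg : Fin c → ℤ) (hpos : ∀ i, 0 < deg i) (hodd : ∀ i, Odd (deg i))
    (e : ExteriorAlgebra k (Fin c → k) ≃ₐ[k] Λ.carrier)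
    (he : ∀ i, e (ExteriorAlgebra.ι k (Pi.single i 1)) ∈ Λ.gr (deg i)) :
    Nonempty (DGModule.SemifreeResolution.{u, v, v, u} (Λ.residueModule e he hpos hd)) ∧
    ∀ R : DGModule.SemifreeResolution.{u, v, w, u} (Λ.residueModule e he hpos hd),
      ∃ Φ : MvPolynomial (Fin c) k ≃ₗ[k] R.Ext (Λ.residueModule e he hpos hd),
        Φ 1 = DGModule.HHom.mk R.F (Λ.residueModule e he hpos hd) R.cycle ∧
        (∀ p q : MvPolynomial (Fin c) k,
          R.IsCompositionProduct R (Λ.residueModule e he hpos hd) (Φ p) (Φ q) (Φ (p * q))) ∧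
        ∀ n : ℤ,
          (MvPolynomial.weightedHomogeneousSubmodule k (fun i => -(deg i + 1)) n).map
              (Φ : MvPolynomial (Fin c) k →ₗ[k] R.Ext (Λ.residueModule e he hpos hd)) =
            DGModule.HHom.deg R.F (Λ.residueModule e he hpos hd) n := by
  refine ⟨⟨koszulResolution he hpos hodd hd⟩, fun R => ?_⟩
  let K := koszulResolution (e := e) he hpos hodd hd
  let T : MvPolynomial (Fin c) k →ₐ[k] Module.End k K.F.carrier := polyAction Λ
  obtain ⟨g, hg, hgε⟩ := R.exists_comparison K
  obtain ⟨h, hh, hhε⟩ := K.exists_comparison R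
  have hgc := chainMaps_le_cycles _ _ _ hg
  have hhc := chainMaps_le_cycles _ _ _ hh
  have hεK := chainMaps_le_cycles _ _ _ K.ε.2
  have hhg := R.comparison_comp K hg hh hgε hhε
  have hgh := K.comparison_comp R hh hg hhε hgε
  have hT : ∀ p, T p ∈ cycles K.F K.F := polyAction_mem_cycles he hodd hd
  have hTdeg : ∀ n, ∀ p ∈ MvPolynomial.weightedHomogeneousSubmodule k (fun i => -(deg i + 1)) n,
      T p ∈ chainMaps K.F K.F n := fun n p hp => polyAction_mem_chainMaps he hodd hd hp
  have hmem : ∀ p, K.ε.1 ∘ₗ T p ∘ₗ g ∈ cycles R.F (Λ.residueModule e he hpos hd) := fun p =>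
    comp_mem_cycles hεK (comp_mem_cycles (hT p) hgc)
  let Ψ : MvPolynomial (Fin c) k →ₗ[k] cycles R.F (Λ.residueModule e he hpos hd) :=
    { toFun := fun p => ⟨K.ε.1 ∘ₗ T p ∘ₗ g, hmem p⟩
      map_add' := fun p q => Subtype.ext (by
        ext x
        simp)
      map_smul' := fun r p => Subtype.ext (by
        ext x
        simp) }
  let Φ₀ : MvPolynomial (Fin c) k →ₗ[k] HHom R.F (Λ.residueModule e he hpos hd) :=
    HHom.mk R.F (Λ.residueModule e he hpos hd) ∘ₗ Ψ
  have hΦ₀ : ∀ p, Φ₀ p = HHom.mk R.F (Λ.residueModule e he hpos hd) (Ψ p) := fun p => rfl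
  -- Up to homotopy f is (f h) g, and f h : K → k equals ε T(p) for a homogeneous p.
  have hlift : ∀ n, ∀ f : cycles R.F (Λ.residueModule e he hpos hd),
      f.1 ∈ chainMaps R.F (Λ.residueModule e he hpos hd) n →
      ∃ p ∈ MvPolynomial.weightedHomogeneousSubmodule k (fun i => -(deg i + 1)) n,
        Φ₀ p = HHom.mk R.F (Λ.residueModule e he hpos hd) f := by
    intro n f hf
    have hfh := comp_mem_chainMaps hf hh
    rw [zero_add] at hfh
    obtain ⟨p, hp, hfp⟩ := exists_polyAction_eq (he := he) (hpos := hpos) (hodd := hodd) (hd := hd)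
      hfh.1
    have hfp' : f.1 ∘ₗ h = K.ε.1 ∘ₗ T p := hfp
    refine ⟨p, hp, ?_⟩
    rw [hΦ₀, eq_comm, HHom.mk_eq_iff]
    have := comp_mem_boundaries_left f.2 hhg
    convert this using 1
    change f.1 - (K.ε.1 ∘ₗ T p) ∘ₗ g = _
    rw [← hfp', LinearMap.comp_sub, LinearMap.comp_id, LinearMap.comp_assoc]
  have hinj : Function.Injective Φ₀ := by
    rw [injective_iff_map_eq_zero]
    intro p hp
    rw [← map_zero (HHom.mk R.F (Λ.residueModule e he hpos hd)), hΦ₀, HHom.mk_eq_iff] at hp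
    have hp' : K.ε.1 ∘ₗ T p ∘ₗ g ∈ boundaries R.F (Λ.residueModule e he hpos hd) := by
      simpa [Ψ] using hp
    -- Composing with h and using g h ∼ 1 makes ε T(p) a boundary on K, hence zero, and its values
    -- are the coefficients of p.
    have h₁ := comp_mem_boundaries_right hp' hhc
    have h₂ := comp_mem_boundaries_left (comp_mem_cycles hεK (hT p)) hgh
    have h₃ : K.ε.1 ∘ₗ T p ∈ boundaries K.F (Λ.residueModule e he hpos hd) := by
      convert add_mem h₁ h₂ using 1
      ext x
      simp
    have h₄ : K.ε.1 ∘ₗ T p = 0 := by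
      have hbot : boundaries K.F (Λ.residueModule e he hpos hd) = ⊥ :=
        boundaries_koszul_eq_bot (hodd := hodd)
      rwa [hbot, Submodule.mem_bot] at h₃
    ext b
    rw [MvPolynomial.coeff_zero, ← koszulAugmentation_polyAction (e := e) p b]
    exact LinearMap.congr_fun h₄ (Finsupp.single b (1 : Λ.carrier) : Koszul Λ c)
  have hsurj : Function.Surjective Φ₀ := by
    rw [← LinearMap.range_eq_top, eq_top_iff]
    rintro f -
    obtain ⟨⟨f, hf⟩, rfl⟩ := Submodule.mkQ_surjective _ f
    obtain ⟨φ, hφ, rfl⟩ := (Submodule.mem_iSup_iff_exists_finsupp _ _).mp hf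
    have hsum : (⟨φ.sum fun _ x => x, hf⟩ : cycles R.F (Λ.residueModule e he hpos hd)) =
        ∑ n ∈ φ.support, ⟨φ n, chainMaps_le_cycles _ _ n (hφ n)⟩ :=
      Subtype.ext (by simp [Finsupp.sum])
    rw [hsum, map_sum]
    refine Submodule.sum_mem _ fun n _ => ?_
    obtain ⟨p, -, hp⟩ := hlift n ⟨φ n, chainMaps_le_cycles _ _ n (hφ n)⟩ (hφ n)
    exact ⟨p, hp⟩
  refine ⟨LinearEquiv.ofBijective Φ₀ ⟨hinj, hsurj⟩, ?_, ?_, ?_⟩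
  · change Φ₀ 1 = _
    rw [hΦ₀, eq_comm, HHom.mk_eq_iff]
    have h₁ : (Ψ 1).1 = K.ε.1 ∘ₗ g := by
      change K.ε.1 ∘ₗ T 1 ∘ₗ g = _
      rw [map_one]
      rfl
    rw [h₁]
    exact hgε
  · intro p q
    change R.IsCompositionProduct R (Λ.residueModule e he hpos hd) (Φ₀ p) (Φ₀ q) (Φ₀ (p * q))
    have hα : ∀ q, h ∘ₗ T q ∘ₗ g ∈ cycles R.F R.F := fun q =>
      comp_mem_cycles hhc (comp_mem_cycles (hT q) hgc)
    have hεα : R.ε.1 ∘ₗ h ∘ₗ T q ∘ₗ g - K.ε.1 ∘ₗ T q ∘ₗ g ∈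
        boundaries R.F (Λ.residueModule e he hpos hd) := by
      have := neg_mem (comp_mem_boundaries_right hhε (comp_mem_cycles (hT q) hgc))
      convert this using 1
      ext x
      simp
    refine ⟨⟨⟨_, hα q⟩, ?_⟩, fun β α' hβ hα' => ?_⟩
    · rw [hΦ₀, HHom.mk_eq_iff]
      exact hεα
    · rw [hΦ₀, HHom.mk_eq_iff] at hβ hα' ⊢
      change β.1 - K.ε.1 ∘ₗ T p ∘ₗ g ∈ _ at hβ
      change R.ε.1 ∘ₗ α'.1 - K.ε.1 ∘ₗ T q ∘ₗ g ∈ _ at hα'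
      change β.1 ∘ₗ α'.1 - K.ε.1 ∘ₗ T (p * q) ∘ₗ g ∈ _
      -- Any lift of the class of q is homotopic to h T(q) g, since composition with ε is injective
      -- on homology.
      have hdiff : α'.1 - h ∘ₗ T q ∘ₗ g ∈ boundaries R.F R.F := by
        refine R.semifree.mem_boundaries R.quasiIso (sub_mem α'.2 (hα q)) ?_
        convert sub_mem hα' hεα using 1
        ext x
        simp
      -- The difference β α' - ε T(pq) g is (β - ε T(p) g) α' + ε T(p) g (α' - h T(q) g) - ε T(p) (1
      -- - g h) T(q) g.
      have h₁ := comp_mem_boundaries_right hβ α'.2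
      have h₂ := comp_mem_boundaries_left (hmem p) hdiff
      have h₃ := comp_mem_boundaries_left (comp_mem_cycles hεK (hT p))
        (comp_mem_boundaries_right hgh (comp_mem_cycles (hT q) hgc))
      convert sub_mem (add_mem h₁ h₂) h₃ using 1
      ext x
      simp [map_mul]
  · intro n
    change Submodule.map Φ₀ _ = _
    refine le_antisymm ?_ ?_
    · rintro _ ⟨p, hp, rfl⟩
      refine ⟨Ψ p, ?_, rfl⟩
      have := comp_mem_chainMaps K.ε.2 (comp_mem_chainMaps (hTdeg n p hp) hg)
      rwa [zero_add, add_zero] at this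
    · rintro _ ⟨f, hf, rfl⟩
      exact hlift n f hf
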